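/- **Notation.** Fix $m\ge 1$, dimensions $d_1,\dots,d_m$ and ranks $r_1,\dots,r_m\ge 1$, and let $\mathbf r=(r_1,\dots,r_m)$. Let $\mathbf M_{(j)}\in\mathbb R^{d_j\times\prod_{k\ne j}d_k}$ be the mode-$j$ matricization of $\mathbf M\in\mathbb R^{d_1\times\cdots\times d_m}$, let $\|\cdot\|_{\rm F}$ and $\langle\cdot,\cdot\rangle$ be the Frobenius norm and the entrywise inner product, let $\mathbf M\cdot[\![\mathbf A_1,\dots,\mathbf A_m]\!]=\mathbf M\times_1\mathbf A_1\times_2\cdots\times_m\mathbf A_m$ be the multilinear product, and let $\mathbb M_{\mathbf r}=\{\mathbf M:\operatorname{rank}(\mathbf M_{(j)})\le r_j\text{ for all }j\}$. For a function $f:\mathbb R^{d_1\times\cdots\times d_m}\to\mathbb R$ let $\partial f(\mathbf M)=\{\mathbf G: f(\mathbf N)\ge f(\mathbf M)+\langle\mathbf G,\mathbf N-\mathbf M\rangle\ \text{for all }\mathbf N\}$. Let $\|\mathbf G\|_{{\rm F},2\mathbf r}=\sup\|\mathbf G\cdot[\![\mathbf U_1^\top,\dots,\mathbf U_m^\top]\!]\|_{\rm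 F}$ over matrices $\mathbf U_j\in\mathbb R^{d_j\times\min(2r_j,d_j)}$ with orthonormal columns. For $\mathbf M^*\in\mathbb M_{\mathbf r}$ let $\underline\lambda=\min_j\sigma_{r_j}(\mathbf M^*_{(j)})$, where $\sigma_k(\cdot)$ is the $k$-th largest singular value ($0$ if $k$ exceeds the rank). **Algorithm (RsGrad).** Start from $\mathbf M_0\in\mathbb M_{\mathbf r}$. For $l=0,\dots,l_{\max}$ choose any $\mathbf G_l\in\partial f(\mathbf M_l)$ and set $\mathbf M_{l+1}=\mathrm{HOSVD}_{\mathbf r}\big(\mathbf M_l-\eta_l\,\mathcal P_{\mathbb T_l}(\mathbf G_l)\big)$. Here, for a Tucker decomposition $\mathbf M_l=\mathbf C\cdot[\![\mathbf U_1,\dots,\mathbf U_m]\!]$ with $\mathbf C\in\mathbb R^{r_1\times\cdots\times r_m}$ and $\mathbf U_j\in\mathbb R^{d_j\times r_j}$ having orthonormal columns, $$\mathcal P_{\mathbb T_l}(\mathbf G)=\mathbf G\cdot[\![\mathbf U_1\mathbf U_1^\top,\dots,\mathbf U_m\mathbf U_m^\top]\!]+\sum_{i=1}^m\mathbf C\times_{j\ne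 i}\mathbf U_j\times_i\dot{\mathbf U}_i,\qquad \dot{\mathbf U}_i=(\mathbf I-\mathbf U_i\mathbf U_i^\top)\,\mathbf G_{(i)}\,\big(\otimes_{j\ne i}\mathbf U_j\big)\,\mathbf C_{(i)}^\dagger ,$$ with $\dagger$ the Moore–Penrose inverse, and $\mathrm{HOSVD}_{\mathbf r}(\mathbf T)=\mathbf T\cdot[\![\mathbf V_1\mathbf V_1^\top,\dots,\mathbf V_m\mathbf V_m^\top]\!]$ with the columns of $\mathbf V_j$ being top-$r_j$ left singular vectors of $\mathbf T_{(j)}$ (any choice in case of ties). **Dual-phase regularity.** Let $\tau_{\rm comp}>\tau_{\rm stat}>0$ and $\mu_{\rm comp},\mu_{\rm stat},L_{\rm comp},L_{\rm stat}>0$, and put $\mathbb B_1=\{\mathbf M\in\mathbb M_{\mathbf r}:\|\mathbf M-\mathbf M^*\|_{\rm F}\ge\tau_{\rm comp}\}$ and $\mathbb B_2=\{\mathbf M\in\mathbb M_{\mathbf r}:\tau_{\rm comp}>\|\mathbf M-\mathbf M^*\|_{\rm F}\ge\tau_{\rm stat}\}$. Assume that * $f(\mathbf M)-f(\mathbf M^*)\ge\mu_{\rm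 comp}\|\mathbf M-\mathbf M^*\|_{\rm F}$ on $\mathbb B_1$ and $f(\mathbf M)-f(\mathbf M^*)\ge\mu_{\rm stat}\|\mathbf M-\mathbf M^*\|_{\rm F}^2$ on $\mathbb B_2$; * for every $\mathbf G\in\partial f(\mathbf M)$, $\|\mathbf G\|_{{\rm F},2\mathbf r}\le L_{\rm comp}$ if $\mathbf M\in\mathbb B_1$ and $\|\mathbf G\|_{{\rm F},2\mathbf r}\le L_{\rm stat}\|\mathbf M-\mathbf M^*\|_{\rm F}$ if $\mathbf M\in\mathbb B_2$. **Proposition.** There is an absolute constant $c_0>0$ (independent of all the quantities above, $m$ included) with the following property. Under the above assumptions, suppose that $$\|\mathbf M_0-\mathbf M^*\|_{\rm F}\le c_0\,\underline\lambda\cdot\min\Big\{\tfrac1{m+1}\tfrac{\mu_{\rm stat}^2}{L_{\rm stat}^2},\ \tfrac1{m+1}\tfrac{\mu_{\rm comp}^2}{L_{\rm comp}^2},\ \tfrac1{m(m+3)}\tfrac{\mu_{\rm stat}}{L_{\rm stat}},\ \tfrac1{m(m+3)}\tfrac{\mu_{\rm comp}}{L_{\rm comp}}\Big\},$$ and that the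 initial (phase-one) stepsize $\eta^{0}$ lies in $\big[\tfrac{0.25}{m+1}\|\mathbf M_0-\mathbf M^*\|_{\rm F}\,\mu_{\rm comp}L_{\rm comp}^{-2},\ \tfrac{0.75}{m+1}\|\mathbf M_0-\mathbf M^*\|_{\rm F}\,\mu_{\rm comp}L_{\rm comp}^{-2}\big]$. Suppose the stepsizes satisfy, for $0\le l\le l_{\max}$, * $\eta_l=\big(1-\tfrac1{16(m+1)}\tfrac{\mu_{\rm comp}^2}{L_{\rm comp}^2}\big)^l\eta^0$ whenever $\|\mathbf M_l-\mathbf M^*\|_{\rm F}\ge\tau_{\rm comp}$ (phase one); * $\eta_l\in\big[\tfrac{0.25}{m+1}\mu_{\rm stat}L_{\rm stat}^{-2},\ \tfrac{0.75}{m+1}\mu_{\rm stat}L_{\rm stat}^{-2}\big]$ whenever $\tau_{\rm comp}>\|\mathbf M_l-\mathbf M^*\|_{\rm F}\ge\tau_{\rm stat}$ (phase two). Then for every $l\le l_{\max}$ such that no earlier iterate has reached the statistical accuracy, i.e. $\|\mathbf M_k-\mathbf M^*\|_{\rm F}\ge\tau_{\rm stat}$ for all $k<l$: 1. if $\|\mathbf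 M_l-\mathbf M^*\|_{\rm F}\ge\tau_{\rm comp}$, then $$\|\mathbf M_{l'}-\mathbf M^*\|_{\rm F}\le\Big(1-\tfrac1{16(m+1)}\tfrac{\mu_{\rm comp}^2}{L_{\rm comp}^2}\Big)^{l'}\|\mathbf M_0-\mathbf M^*\|_{\rm F}\qquad\text{for } l'=l\text{ and }l'=l+1;$$ 2. if $\tau_{\rm comp}>\|\mathbf M_l-\mathbf M^*\|_{\rm F}\ge\tau_{\rm stat}$, then $$\|\mathbf M_{l+1}-\mathbf M^*\|_{\rm F}\le\Big(1-\tfrac1{16(m+1)}\tfrac{\mu_{\rm stat}^2}{L_{\rm stat}^2}\Big)\|\mathbf M_l-\mathbf M^*\|_{\rm F}.$$ -/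

import Mathlib

namespace TensorRsGrad

/-- Real `m`-th order tensors of size `d 0 × ⋯ × d (m-1)`. The norm of this Euclidean space is the
Frobenius norm, its inner product the entrywise one. -/
abbrev Tensor {m : ℕ} (d : Fin m → ℕ) : Type :=
  EuclideanSpace ℝ ((j : Fin m) → Fin (d j))

/-- The multi-index that has entry `a` in position `j` and the entries of `b` elsewhere. -/
def glue {m : ℕ} {d : Fin m → ℕ} (j : Fin m) (a : Fin (d j))
    (b : (k : {k : Fin m // k ≠ j}) → Fin (d k)) : (k : Fin m) → Fin (d k) :=
  (Equiv.piSplitAt j fun k => Fin (d k)).symm (a, b)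

/-- The mode-`j` matricization, a matrix with `d j` rows and `∏_{k ≠ j} d k` columns. -/
def unfold {m : ℕ} {d : Fin m → ℕ} (T : Tensor d) (j : Fin m) :
    Matrix (Fin (d j)) ((k : {k : Fin m // k ≠ j}) → Fin (d k)) ℝ :=
  Matrix.of fun a b => T (glue j a b)

/-- The multilinear product `T ×₁ A₁ ×₂ ⋯ ×ₘ Aₘ`. -/
noncomputable def multiMul {m : ℕ} {d e : Fin m → ℕ} (T : Tensor d)
    (A : (j : Fin m) → Matrix (Fin (e j)) (Fin (d j)) ℝ) : Tensor e :=
  WithLp.toLp 2 fun i => ∑ k : (j : Fin m) → Fin (d j), T k * ∏ j, A j (i j) (k j)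

/-- The Kronecker product `⊗_{k ≠ j} A_k`, its rows and columns indexed as the columns of the
mode-`j` matricizations. -/
def kronExcept {m : ℕ} {d e : Fin m → ℕ} (A : (j : Fin m) → Matrix (Fin (e j)) (Fin (d j)) ℝ)
    (j : Fin m) : Matrix ((k : {k : Fin m // k ≠ j}) → Fin (e k))
      ((k : {k : Fin m // k ≠ j}) → Fin (d k)) ℝ :=
  Matrix.of fun a b => ∏ k : {k : Fin m // k ≠ j}, A k (a k) (b k)

/-- The tensors of Tucker rank at most `r`. -/
def tuckerSet {m : ℕ} (d r : Fin m → ℕ) : Set (Tensor d) :=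
  {M | ∀ j, (unfold M j).rank ≤ r j}

/-- The `k`-th largest singular value of a real matrix, with `k = 0` for the largest one. It is `0`
for all `k` from the rank on. -/
noncomputable def singVal {p q : Type*} [Fintype p] [Fintype q] [DecidableEq q]
    (A : Matrix p q ℝ) (k : ℕ) : ℝ :=
  (Matrix.toEuclideanLin A).singularValues k

/-- The signal strength `min_j σ_{r_j}(M_(j))`, for ranks `r j ≥ 1`. -/
noncomputable def signal {m : ℕ} {d : Fin m → ℕ} (r : Fin m → ℕ) (M : Tensor d) : ℝ :=
  ⨅ j, singVal (unfold M j) (r j - 1)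

/-- The columns of `U` are leading left singular vectors of `A`, in order. In case of ties among
the singular values any choice is admitted. -/
def IsLeadingLeftSingular {p q : Type*} [Fintype p] [Fintype q] [DecidableEq q] {s : ℕ}
    (A : Matrix p q ℝ) (U : Matrix p (Fin s) ℝ) : Prop :=
  U.transpose * U = 1 ∧
    ∀ k : Fin s, (A * A.transpose).mulVec (U.col k) = singVal A k ^ 2 • U.col k

/-- `T'` is a rank-`r` truncated higher-order SVD of `T`. -/
def IsHOSVD {m : ℕ} {d : Fin m → ℕ} (r : Fin m → ℕ) (T T' : Tensor d) : Prop :=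
  ∃ U : (j : Fin m) → Matrix (Fin (d j)) (Fin (r j)) ℝ,
    (∀ j, IsLeadingLeftSingular (unfold T j) (U j)) ∧
      T' = multiMul T fun j => U j * (U j).transpose

/-- `B` is the Moore–Penrose inverse of the real matrix `A`. -/
def IsMoorePenrose {p q : Type*} [Fintype p] [Fintype q]
    (A : Matrix p q ℝ) (B : Matrix q p ℝ) : Prop :=
  A * B * A = A ∧ B * A * B = B ∧ (A * B).transpose = A * B ∧ (B * A).transpose = B * A

/-- `W` is the projection of `G` onto the tangent space at `M` of the tensors of Tucker rank `r`,
computed from a Tucker decomposition `M = C · ⟦U₁, …, Uₘ⟧` with orthonormal factors by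
`W = G · ⟦U₁U₁ᵀ, …, UₘUₘᵀ⟧ + ∑ᵢ C ×_{j ≠ i} U_j ×_i U̇ᵢ`, where
`U̇ᵢ = (I - UᵢUᵢᵀ) G_(i) (⊗_{j ≠ i} U_j) C_(i)†`. -/
def IsTangentProj {m : ℕ} {d : Fin m → ℕ} (r : Fin m → ℕ) (M G W : Tensor d) : Prop :=
  ∃ (C : Tensor r) (U : (j : Fin m) → Matrix (Fin (d j)) (Fin (r j)) ℝ)
    (P : (i : Fin m) → Matrix ((k : {k : Fin m // k ≠ i}) → Fin (r k)) (Fin (r i)) ℝ),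
    (∀ j, (U j).transpose * U j = 1) ∧
    M = multiMul C U ∧
    (∀ i, IsMoorePenrose (unfold C i) (P i)) ∧
    W = multiMul G (fun j => U j * (U j).transpose) +
      ∑ i, multiMul C (Function.update U i
        ((1 - U i * (U i).transpose) * unfold G i * kronExcept U i * P i))

/-- The sub-differential `∂f(M)`. -/
def subgradients {m : ℕ} {d : Fin m → ℕ} (f : Tensor d → ℝ) (M : Tensor d) : Set (Tensor d) :=
  {G | ∀ N, f M + inner ℝ G (N - M) ≤ f N}

/-- One iteration of the Riemannian sub-gradient algorithm: from `M` with stepsize `η` to `M'`. -/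
def RsGradStep {m : ℕ} {d : Fin m → ℕ} (r : Fin m → ℕ) (f : Tensor d → ℝ) (M : Tensor d) (η : ℝ)
    (M' : Tensor d) : Prop :=
  ∃ G ∈ subgradients f M, ∃ W, IsTangentProj r M G W ∧ IsHOSVD r (M - η • W) M'

/-- The truncated Frobenius norm `‖G‖_{F,s}`, the supremum of `‖G · ⟦U₁ᵀ, …, Uₘᵀ⟧‖_F` over matrices
`U_j` with `s j` orthonormal columns, or `d j` columns where `s j > d j`. -/
noncomputable def truncNorm {m : ℕ} {d : Fin m → ℕ} (s : Fin m → ℕ) (G : Tensor d) : ℝ :=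
  sSup {x | ∃ U : (j : Fin m) → Matrix (Fin (d j)) (Fin (min (s j) (d j))) ℝ,
    (∀ j, (U j).transpose * U j = 1) ∧ x = ‖multiMul G fun j => (U j).transpose‖}

/-- The region `𝔹₁` far away from the truth. -/
def regionOne {m : ℕ} {d : Fin m → ℕ} (r : Fin m → ℕ) (Mstar : Tensor d) (τcomp : ℝ) :
    Set (Tensor d) :=
  {M | M ∈ tuckerSet d r ∧ τcomp ≤ ‖M - Mstar‖}

/-- The region `𝔹₂` near the truth. -/
def regionTwo {m : ℕ} {d : Fin m → ℕ} (r : Fin m → ℕ) (Mstar : Tensor d) (τcomp τstat : ℝ) :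
    Set (Tensor d) :=
  {M | M ∈ tuckerSet d r ∧ τstat ≤ ‖M - Mstar‖ ∧ ‖M - Mstar‖ < τcomp}

/-- Dual-phase sharpness. -/
def DualPhaseSharp {m : ℕ} {d : Fin m → ℕ} (r : Fin m → ℕ) (f : Tensor d → ℝ) (Mstar : Tensor d)
    (τcomp τstat μcomp μstat : ℝ) : Prop :=
  (∀ M ∈ regionOne r Mstar τcomp, μcomp * ‖M - Mstar‖ ≤ f M - f Mstar) ∧
  (∀ M ∈ regionTwo r Mstar τcomp τstat, μstat * ‖M - Mstar‖ ^ 2 ≤ f M - f Mstar)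

/-- Dual-phase sub-gradient bound. -/
def DualPhaseSubgradBound {m : ℕ} {d : Fin m → ℕ} (r : Fin m → ℕ) (f : Tensor d → ℝ)
    (Mstar : Tensor d) (τcomp τstat Lcomp Lstat : ℝ) : Prop :=
  (∀ M ∈ regionOne r Mstar τcomp, ∀ G ∈ subgradients f M,
    truncNorm (fun j => 2 * r j) G ≤ Lcomp) ∧
  (∀ M ∈ regionTwo r Mstar τcomp τstat, ∀ G ∈ subgradients f M,
    truncNorm (fun j => 2 * r j) G ≤ Lstat * ‖M - Mstar‖)

end TensorRsGrad

open TensorRsGrad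

namespace TensorRsGrad

/-! The proof is a one-step contraction, `RsGradStep.norm_sub_le`, used with different constants in
the two phases. Write E for the error ‖M - M*‖, λ for the signal, κ = μ² / ((m+1) L²), and T = M -
ηW for the iterate before truncation, where W is the projection of the sub-gradient G. Expanding the
square gives ‖T - M*‖² = E² - 2η⟨W, M - M*⟩ + η²‖W‖².

The linear term: the tangent projection is self-adjoint and fixes M, so ⟨W, M - M*⟩ is ⟨G, M - M*⟩,
at least μE by sharpness, minus the pairing of G with P(M*) - M*. That tensor has Tucker rank at
most 2r and norm at most 2mE²/λ (`norm_tangentProj_sub_le`), so the correction is of second order.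
The quadratic term: W is a sum of m + 1 orthogonal pieces of Tucker rank at most r, each of norm at
most L (`norm_tangentProj_sq_le`). The stepsize then gains a factor 1 - 0.4κ on the squared error.

The truncation must not spend this gain, so a quasi-optimality bound with a constant factor is
useless. `norm_hosvd_sub_sq_le` shows that it adds only a multiple of (mδ/λ)²δ² to the squared
error, where δ bounds ‖T - M*‖. The warm start makes this a small fraction of κδ². Conditioning is
only ever asked of M*, through a generalized inverse of norm at most 1/λ; the core of an iterate may
be degenerate.

In phase one the step is applied to the majorant qˡ‖M₀ - M*‖, to which the geometric stepsizes are
tuned. In phase two it is applied to E itself with the constants `μstat * E` and `Lstat * E`, which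
have the same ratio as `μstat` and `Lstat`. -/

theorem norm_sq_sum_basis {E ι : Type*} [NormedAddCommGroup E] [InnerProductSpace ℝ E]
    [Fintype ι] (v : OrthonormalBasis ι ℝ E) (c : ι → ℝ) :
    ‖∑ i, c i • v i‖ ^ 2 = ∑ i, c i ^ 2 := by
  rw [← real_inner_self_eq_norm_sq, v.orthonormal.inner_sum]
  simp [sq]

/-! ### Singular values of linear maps: Weyl's inequality and generalized inverses. -/

section SingularValues

open Module

variable {E F : Type*} [NormedAddCommGroup E] [InnerProductSpace ℝ E] [FiniteDimensional ℝ E]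
  [NormedAddCommGroup F] [InnerProductSpace ℝ F] [FiniteDimensional ℝ F]

/-- Eigenvectors of T*T. Orthogonality of the images replaces left singular vectors, which would
need separate care at the value zero. -/
theorem exists_singular_basis (T : E →ₗ[ℝ] F) :
    ∃ v : OrthonormalBasis (Fin (finrank ℝ E)) ℝ E,
      ∀ i j, inner ℝ (T (v i)) (T (v j)) = if i = j then T.singularValues i ^ 2 else 0 := by
  refine ⟨T.isSymmetric_adjoint_comp_self.eigenvectorBasis rfl, fun i j => ?_⟩
  rw [← LinearMap.adjoint_inner_right]
  have h := T.isSymmetric_adjoint_comp_self.apply_eigenvectorBasis rfl j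
  rw [LinearMap.comp_apply] at h
  rw [h, inner_smul_right, OrthonormalBasis.inner_eq_ite, T.sq_singularValues_fin rfl]
  split_ifs with hij
  · subst hij; simp
  · simp

theorem norm_sq_sum_singular {T : E →ₗ[ℝ] F} {v : OrthonormalBasis (Fin (finrank ℝ E)) ℝ E}
    (hv : ∀ i j, inner ℝ (T (v i)) (T (v j)) = if i = j then T.singularValues i ^ 2 else 0)
    (c : Fin (finrank ℝ E) → ℝ) :
    ‖T (∑ i, c i • v i)‖ ^ 2 = ∑ i : Fin (finrank ℝ E), T.singularValues i ^ 2 * c i ^ 2 := by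
  rw [← real_inner_self_eq_norm_sq]
  simp only [map_sum, map_smul, sum_inner, inner_sum, inner_smul_left, inner_smul_right, hv]
  simp only [conj_trivial, mul_ite, mul_zero, Finset.sum_ite_eq', Finset.mem_univ, if_true]
  exact Finset.sum_congr rfl fun i _ => by ring

/-- The Weyl inequality for singular values. -/
theorem singularValues_le_add (T S : E →ₗ[ℝ] F) {c : ℝ} (hc : ∀ x, ‖T x - S x‖ ≤ c * ‖x‖)
    (hc0 : 0 ≤ c) (k : ℕ) : T.singularValues k ≤ S.singularValues k + c := by
  rcases le_or_gt (finrank ℝ E) k with hk | hk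
  · rw [T.singularValues_of_finrank_le hk]
    have := S.singularValues_nonneg k
    linarith
  obtain ⟨v, hv⟩ := exists_singular_basis T
  obtain ⟨w, hw⟩ := exists_singular_basis S
  let e : Fin (k + 1) → Fin (finrank ℝ E) := Fin.castLE hk
  have he : Function.Injective e := Fin.castLE_injective hk
  -- Courant–Fischer by dimension count: among the combinations of the first k + 1 singular vectors
  -- of `T`, some non-zero `x` is orthogonal to the first k of `S`. On it `T` stretches by at least
  -- its k-th value and `S` by at most its own.
  let f : (Fin (k + 1) → ℝ) →ₗ[ℝ] (Fin k → ℝ) :=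
    LinearMap.pi fun j => (innerₗ E (w (Fin.castLE hk.le j))) ∘ₗ
      (Fintype.linearCombination ℝ fun i => v (e i))
  have hf : LinearMap.ker f ≠ ⊥ := LinearMap.ker_ne_bot_of_finrank_lt (by simp)
  obtain ⟨a, ha, ha0⟩ := Submodule.exists_mem_ne_zero_of_ne_bot hf
  let b : Fin (finrank ℝ E) → ℝ := fun i =>
    if h : (i : ℕ) ≤ k then a ⟨i, Nat.lt_succ_of_le h⟩ else 0
  set x : E := ∑ i, b i • v i with hx
  have hxa : x = Fintype.linearCombination ℝ (fun i => v (e i)) a := by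
    rw [hx, Fintype.linearCombination_apply]
    symm
    refine Finset.sum_of_injOn e he.injOn (by simp) ?_ ?_
    · intro i _ hi
      have : ¬ (i : ℕ) ≤ k := fun h => hi ⟨⟨i, Nat.lt_succ_of_le h⟩, by simp, by ext; simp [e]⟩
      simp [b, this]
    · intro i _
      simp [b, e, Nat.lt_succ_iff.1 i.2]
  have hxw : ∀ j : Fin (finrank ℝ E), (j : ℕ) < k → inner ℝ (w j) x = 0 := by
    intro j hj
    have := congrFun (LinearMap.mem_ker.1 ha) ⟨j, hj⟩
    rw [hxa]
    simpa [f] using this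
  have hx0 : 0 < ‖x‖ ^ 2 := by
    rw [hx, norm_sq_sum_basis]
    obtain ⟨i, hi⟩ := Function.ne_iff.1 ha0
    refine Finset.sum_pos' (fun _ _ => sq_nonneg _) ⟨e i, Finset.mem_univ _, ?_⟩
    have : b (e i) = a i := by simp [b, e, Nat.lt_succ_iff.1 i.2]
    rw [this]
    have : a i ≠ 0 := hi
    positivity
  have hT : T.singularValues k ^ 2 * ‖x‖ ^ 2 ≤ ‖T x‖ ^ 2 := by
    rw [hx, norm_sq_sum_singular hv, norm_sq_sum_basis, Finset.mul_sum]
    refine Finset.sum_le_sum fun i _ => ?_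
    by_cases h : (i : ℕ) ≤ k
    · have := T.singularValues_antitone h
      have := T.singularValues_nonneg k
      gcongr
    · simp [b, h]
  have hS : ‖S x‖ ^ 2 ≤ S.singularValues k ^ 2 * ‖x‖ ^ 2 := by
    have hxs : x = ∑ i, (inner ℝ (w i) x) • w i := (w.sum_repr' x).symm
    rw [hxs, norm_sq_sum_singular hw, norm_sq_sum_basis, Finset.mul_sum]
    refine Finset.sum_le_sum fun i _ => ?_
    by_cases h : (i : ℕ) < k
    · simp [hxw i h]
    · have := S.singularValues_antitone (not_lt.1 h)
      have := S.singularValues_nonneg i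
      gcongr
  have hx1 : 0 < ‖x‖ := by
    by_contra h
    have : ‖x‖ = 0 := le_antisymm (not_lt.1 h) (norm_nonneg _)
    simp [this] at hx0
  have hT' : T.singularValues k * ‖x‖ ≤ ‖T x‖ :=
    le_of_sq_le_sq (by rwa [mul_pow]) (norm_nonneg _)
  have hS' : ‖S x‖ ≤ S.singularValues k * ‖x‖ :=
    le_of_sq_le_sq (by rwa [mul_pow]) (mul_nonneg (S.singularValues_nonneg k) hx1.le)
  have h3 : ‖T x‖ ≤ ‖S x‖ + c * ‖x‖ := by
    have := norm_sub_norm_le (T x) (S x)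
    linarith [hc x]
  refine le_of_mul_le_mul_right ?_ hx1
  linarith

/-- A generalized inverse bounded by the reciprocal of the least non-zero singular value. -/
theorem exists_bounded_inverse (T : E →ₗ[ℝ] F) {r : ℕ} {lam : ℝ} (hlam : 0 < lam)
    (hT : lam ≤ T.singularValues (r - 1)) (hr : finrank ℝ T.range ≤ r) :
    ∃ g : F →ₗ[ℝ] E, (∀ x, T (g (T x)) = T x) ∧ ∀ y, ‖g y‖ ≤ lam⁻¹ * ‖y‖ := by
  obtain ⟨v, hv⟩ := exists_singular_basis T
  have key : ∀ i : ℕ, T.singularValues i = 0 ∨ lam ≤ T.singularValues i := by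
    intro i
    rcases le_or_gt i (r - 1) with h | h
    · exact Or.inr (hT.trans (T.singularValues_antitone h))
    · exact Or.inl (T.singularValues_eq_zero_iff_le_finrank_range.2 (by omega))
  -- The weights of the pseudo-inverse ∑ σᵢ⁻² ⟨T vᵢ, ·⟩ vᵢ. If σᵢ = 0, then T vᵢ = 0 and the term
  -- vanishes.
  let s : Fin (finrank ℝ E) → ℝ := fun i => (T.singularValues i ^ 2)⁻¹
  let g : F →ₗ[ℝ] E := ∑ i, s i • (innerₗ F (T (v i))).smulRight (v i)
  have hg : ∀ y, g y = ∑ i, (s i * inner ℝ (T (v i)) y) • v i := by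
    intro y
    simp [g, LinearMap.sum_apply, smul_smul]
  refine ⟨g, fun x => ?_, fun y => ?_⟩
  · have : T ∘ₗ g ∘ₗ T = T := by
      refine v.toBasis.ext fun i => ?_
      simp only [OrthonormalBasis.coe_toBasis, LinearMap.comp_apply, hg, hv]
      simp only [mul_ite, mul_zero, ite_smul, zero_smul, Finset.sum_ite_eq', Finset.mem_univ,
        if_true, map_smul]
      rcases eq_or_ne (T.singularValues i) 0 with h | h
      · have h0 := hv i i
        rw [if_pos rfl, h, real_inner_self_eq_norm_sq] at h0
        have : T (v i) = 0 := by simpa using h0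
        simp [this]
      · have : s i * T.singularValues i ^ 2 = 1 := inv_mul_cancel₀ (by positivity)
        rw [this, one_smul]
    exact congrArg (fun f : E →ₗ[ℝ] F => f x) this
  · set c : Fin (finrank ℝ E) → ℝ := fun i => s i * inner ℝ (T (v i)) y with hc
    have h1 : ‖g y‖ ^ 2 = ∑ i, c i ^ 2 := by rw [hg, norm_sq_sum_basis]
    -- Duality: ‖g y‖² is `y` paired with a vector of norm at most ‖g y‖ / `lam`, and Cauchy–Schwarz
    -- gives the bound after division by ‖g y‖.
    have h2 : ‖g y‖ ^ 2 = inner ℝ (T (∑ i, (s i * c i) • v i)) y := by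
      rw [h1]
      simp only [map_sum, map_smul, sum_inner, inner_smul_left]
      refine Finset.sum_congr rfl fun i _ => ?_
      simp [hc]; ring
    have h3 : ‖T (∑ i, (s i * c i) • v i)‖ ≤ lam⁻¹ * ‖g y‖ := by
      refine le_of_sq_le_sq ?_ (by positivity)
      rw [norm_sq_sum_singular hv, mul_pow, h1, Finset.mul_sum]
      refine Finset.sum_le_sum fun i _ => ?_
      rcases key i with h | h
      · simp only [h]
        rw [zero_pow two_ne_zero, zero_mul]
        positivity
      · have hp : 0 < T.singularValues i := hlam.trans_le h
        have : T.singularValues i ^ 2 * (s i * c i) ^ 2 = (T.singularValues i)⁻¹ ^ 2 * c i ^ 2 := by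
          simp only [s]; field_simp
        rw [this]
        gcongr
    have h4 : ‖g y‖ ^ 2 ≤ lam⁻¹ * ‖g y‖ * ‖y‖ := by
      rw [h2]
      exact (real_inner_le_norm _ _).trans (by gcongr)
    rcases (norm_nonneg (g y)).eq_or_lt with h | h
    · rw [← h]; positivity
    · refine le_of_mul_le_mul_left ?_ h
      nlinarith

end SingularValues

/-! ### Frobenius and operator norms of matrices; leading singular subspaces under perturbation. -/

section Matrices

open Matrix
open scoped Matrix.Norms.L2Operator

variable {p q s t : Type*} [Fintype p] [Fintype q] [Fintype s] [Fintype t]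

/-- The entrywise inner product of real matrices. -/
def ip (A B : Matrix p q ℝ) : ℝ := trace (Aᵀ * B)

/-- The Frobenius norm of a real matrix. -/
noncomputable def fro (A : Matrix p q ℝ) : ℝ := √(ip A A)

theorem ip_eq_sum (A B : Matrix p q ℝ) : ip A B = ∑ i, ∑ j, A i j * B i j := by
  rw [Finset.sum_comm]
  simp [ip, trace, Matrix.mul_apply]

theorem ip_comm (A B : Matrix p q ℝ) : ip A B = ip B A := by
  simp only [ip_eq_sum, mul_comm]

theorem ip_sub_right (A B C : Matrix p q ℝ) : ip A (B - C) = ip A B - ip A C := by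
  simp [ip, Matrix.mul_sub]

theorem ip_transpose (A B : Matrix p q ℝ) : ip Aᵀ Bᵀ = ip A B := by
  rw [ip_eq_sum, ip_eq_sum, Finset.sum_comm]
  rfl

theorem ip_mul_left (F : Matrix s p ℝ) (A : Matrix p q ℝ) (B : Matrix s q ℝ) :
    ip (F * A) B = ip A (Fᵀ * B) := by
  simp [ip, Matrix.mul_assoc]

theorem ip_mul_right (A : Matrix p q ℝ) (Z : Matrix q s ℝ) (B : Matrix p s ℝ) :
    ip (A * Z) B = ip A (B * Zᵀ) := by
  rw [ip, transpose_mul, Matrix.mul_assoc, trace_mul_comm, ip, Matrix.mul_assoc]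

theorem ip_self_nonneg (A : Matrix p q ℝ) : 0 ≤ ip A A := by
  rw [ip_eq_sum]
  exact Finset.sum_nonneg fun _ _ => Finset.sum_nonneg fun _ _ => mul_self_nonneg _

theorem fro_sq (A : Matrix p q ℝ) : fro A ^ 2 = ip A A := Real.sq_sqrt (ip_self_nonneg A)

theorem fro_nonneg (A : Matrix p q ℝ) : 0 ≤ fro A := Real.sqrt_nonneg _

theorem fro_transpose (A : Matrix p q ℝ) : fro Aᵀ = fro A := by
  rw [fro, fro, ip_transpose]

theorem ip_eq_inner (A B : Matrix p q ℝ) :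
    ip A B = inner ℝ (WithLp.toLp 2 fun x : p × q => A x.1 x.2 : EuclideanSpace ℝ (p × q))
      (WithLp.toLp 2 fun x : p × q => B x.1 x.2) := by
  rw [ip_eq_sum, PiLp.inner_apply, Fintype.sum_prod_type]
  simp [mul_comm]

theorem fro_eq_norm (A : Matrix p q ℝ) :
    fro A = ‖(WithLp.toLp 2 fun x : p × q => A x.1 x.2 : EuclideanSpace ℝ (p × q))‖ := by
  rw [fro, ip_eq_inner, real_inner_self_eq_norm_sq, Real.sqrt_sq (norm_nonneg _)]

theorem abs_ip_le (A B : Matrix p q ℝ) : |ip A B| ≤ fro A * fro B := by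
  rw [ip_eq_inner, fro_eq_norm, fro_eq_norm]
  exact abs_real_inner_le_norm _ _

theorem fro_sub_le (A B : Matrix p q ℝ) : fro (A - B) ≤ fro A + fro B := by
  refine le_of_sq_le_sq ?_ (add_nonneg (fro_nonneg _) (fro_nonneg _))
  have h := (abs_le.1 (abs_ip_le A B)).1
  rw [fro_sq, ip_sub_right, ip_comm, ip_sub_right, ip_comm (A - B), ip_sub_right, ip_comm B A,
    add_sq, fro_sq, fro_sq]
  linarith

theorem opNorm_transpose [DecidableEq p] [DecidableEq q] (A : Matrix p q ℝ) : ‖Aᵀ‖ = ‖A‖ := by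
  rw [← conjTranspose_eq_transpose_of_trivial, l2_opNorm_conjTranspose]

theorem dotProduct_mulVec_self_le [DecidableEq q] (F : Matrix p q ℝ) (x : q → ℝ) :
    (F *ᵥ x) ⬝ᵥ (F *ᵥ x) ≤ ‖F‖ ^ 2 * (x ⬝ᵥ x) := by
  have h := F.l2_opNorm_mulVec (WithLp.toLp 2 x)
  have h2 := pow_le_pow_left₀ (norm_nonneg _) h 2
  rw [mul_pow, EuclideanSpace.real_norm_sq_eq, EuclideanSpace.real_norm_sq_eq] at h2
  simpa [dotProduct, sq] using h2

theorem opNorm_le_of_dotProduct [DecidableEq q] (F : Matrix p q ℝ) {c : ℝ} (hc : 0 ≤ c)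
    (h : ∀ x, (F *ᵥ x) ⬝ᵥ (F *ᵥ x) ≤ c ^ 2 * (x ⬝ᵥ x)) : ‖F‖ ≤ c := by
  rw [l2_opNorm_def]
  refine ContinuousLinearMap.opNorm_le_bound _ hc fun x => ?_
  refine le_of_sq_le_sq ?_ (by positivity)
  rw [mul_pow, EuclideanSpace.real_norm_sq_eq, EuclideanSpace.real_norm_sq_eq]
  simpa [dotProduct, sq] using h x.ofLp

theorem fro_mul_le [DecidableEq p] (F : Matrix s p ℝ) (A : Matrix p q ℝ) :
    fro (F * A) ≤ ‖F‖ * fro A := by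
  refine le_of_sq_le_sq ?_ (mul_nonneg (norm_nonneg _) (fro_nonneg _))
  rw [mul_pow, fro_sq, fro_sq, ip, ip, trace, trace, Finset.mul_sum]
  refine Finset.sum_le_sum fun j _ => ?_
  have := dotProduct_mulVec_self_le F (A.col j)
  simpa [Matrix.mul_apply, dotProduct, mulVec, Matrix.col, mul_comm] using this

theorem fro_mul_le' [DecidableEq p] [DecidableEq q] (A : Matrix s p ℝ) (F : Matrix p q ℝ) :
    fro (A * F) ≤ fro A * ‖F‖ := by
  rw [← fro_transpose, transpose_mul, mul_comm (fro A)]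
  refine (fro_mul_le _ _).trans ?_
  rw [opNorm_transpose, fro_transpose]

theorem opNorm_le_fro [DecidableEq q] (A : Matrix p q ℝ) : ‖A‖ ≤ fro A := by
  refine opNorm_le_of_dotProduct A (fro_nonneg A) fun x => ?_
  rw [fro_sq, ip_eq_sum, dotProduct, Finset.sum_mul]
  refine Finset.sum_le_sum fun i _ => ?_
  have := Finset.sum_mul_sq_le_sq_mul_sq Finset.univ (A i) x
  simpa [mulVec, dotProduct, sq] using this

theorem opNorm_le_one_of_proj [DecidableEq p] {P : Matrix p p ℝ} (hP : Pᵀ = P) (hP2 : P * P = P) :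
    ‖P‖ ≤ 1 := by
  have h := l2_opNorm_conjTranspose_mul_self P
  rw [conjTranspose_eq_transpose_of_trivial, hP, hP2] at h
  by_contra hc
  nlinarith [norm_nonneg P]

theorem compl_proj [DecidableEq p] {P : Matrix p p ℝ} (hP : Pᵀ = P) (hP2 : P * P = P) :
    (1 - P)ᵀ = 1 - P ∧ (1 - P) * (1 - P) = 1 - P := by
  refine ⟨by simp [hP], ?_⟩
  simp [Matrix.sub_mul, Matrix.mul_sub, hP2]

theorem fro_proj_mul_le [DecidableEq p] {P : Matrix p p ℝ} (hP : Pᵀ = P) (hP2 : P * P = P)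
    (A : Matrix p q ℝ) : fro (P * A) ≤ fro A :=
  (fro_mul_le P A).trans
    (mul_le_of_le_one_left (fro_nonneg A) (opNorm_le_one_of_proj hP hP2))

theorem fro_mul_proj_le [DecidableEq q] {P : Matrix q q ℝ} (hP : Pᵀ = P) (hP2 : P * P = P)
    (A : Matrix p q ℝ) : fro (A * P) ≤ fro A :=
  (fro_mul_le' A P).trans
    (mul_le_of_le_one_right (fro_nonneg A) (opNorm_le_one_of_proj hP hP2))

theorem opNorm_proj_mul_le [DecidableEq p] [DecidableEq q] {P : Matrix p p ℝ} (hP : Pᵀ = P)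
    (hP2 : P * P = P) (A : Matrix p q ℝ) : ‖P * A‖ ≤ ‖A‖ :=
  (l2_opNorm_mul P A).trans
    (mul_le_of_le_one_left (norm_nonneg A) (opNorm_le_one_of_proj hP hP2))

theorem finrank_range_toEuclideanLin [DecidableEq q] (A : Matrix p q ℝ) :
    Module.finrank ℝ (toEuclideanLin A).range = A.rank := by
  classical
  change Module.finrank ℝ (toLpLin 2 2 A).range = A.rank
  rw [toLpLin_eq_toLin]
  exact (A.rank_eq_finrank_range_toLin _ _).symm

theorem singVal_le_add [DecidableEq q] (A B : Matrix p q ℝ) (k : ℕ) :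
    singVal A k ≤ singVal B k + ‖A - B‖ := by
  refine singularValues_le_add _ _ (fun x => ?_) (norm_nonneg _) k
  have h := (A - B).l2_opNorm_mulVec x
  rw [Matrix.sub_mulVec] at h
  exact h

theorem exists_matrix_bounded_inverse [DecidableEq p] [DecidableEq q] {A : Matrix p q ℝ} {r : ℕ}
    {lam : ℝ} (hlam : 0 < lam) (hA : lam ≤ singVal A (r - 1)) (hr : A.rank ≤ r) :
    ∃ B : Matrix q p ℝ, A * B * A = A ∧ ‖B‖ ≤ lam⁻¹ := by
  obtain ⟨g, hg, hg'⟩ := exists_bounded_inverse (toEuclideanLin A) hlam hA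
    ((finrank_range_toEuclideanLin A).trans_le hr)
  obtain ⟨B, rfl⟩ := (toEuclideanLin (𝕜 := ℝ) (m := q) (n := p)).surjective g
  refine ⟨B, ?_, ?_⟩
  · refine Matrix.ext_of_mulVec_single fun j => ?_
    have := congrArg WithLp.ofLp (hg (WithLp.toLp 2 (Pi.single j 1)))
    rw [← mulVec_mulVec, ← mulVec_mulVec]
    exact this
  · rw [l2_opNorm_def]
    exact ContinuousLinearMap.opNorm_le_bound _ (by positivity) hg'

theorem mul_transpose_mul_leading [DecidableEq q] {r : ℕ} {B : Matrix p q ℝ}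
    {U : Matrix p (Fin r) ℝ} (hU : IsLeadingLeftSingular B U) :
    B * Bᵀ * U = U * diagonal fun k : Fin r => singVal B k ^ 2 := by
  ext i k
  have := congrFun (hU.2 k) i
  rw [mul_diagonal]
  simp only [Pi.smul_apply, smul_eq_mul] at this
  rw [mul_comm, Matrix.mul_apply]
  exact this

/-- The projection onto leading left singular vectors commutes with `B * Bᵀ`. -/
theorem compl_leading_mul [DecidableEq p] [DecidableEq q] {r : ℕ} {B : Matrix p q ℝ}
    {U : Matrix p (Fin r) ℝ} (hU : IsLeadingLeftSingular B U) :
    (1 - U * Uᵀ) * B * ((1 - U * Uᵀ) * B)ᵀ = (1 - U * Uᵀ) * B * Bᵀ := by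
  have h := mul_transpose_mul_leading hU
  have h1 : (1 - U * Uᵀ) * B * Bᵀ * U = 0 := by
    rw [Matrix.mul_assoc _ B, Matrix.mul_assoc _ (B * Bᵀ), h, ← Matrix.mul_assoc, Matrix.sub_mul,
      Matrix.mul_assoc U, hU.1]
    simp
  have h2 : (1 - U * Uᵀ)ᵀ = 1 - U * Uᵀ := by simp
  rw [transpose_mul, h2, ← Matrix.mul_assoc, Matrix.mul_sub, ← Matrix.mul_assoc _ U, h1]
  simp

/-- Leading left singular vectors of a perturbed low-rank matrix capture all directions in which
the perturbed matrix exceeds the size of the perturbation. -/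
theorem opNorm_compl_leading_le [DecidableEq p] [DecidableEq q] {r : ℕ} {A B : Matrix p q ℝ}
    {U : Matrix p (Fin r) ℝ} (hU : IsLeadingLeftSingular B U) (hr : A.rank ≤ r) {lam δ : ℝ}
    (hA : lam ≤ singVal A (r - 1)) (hδ : ‖B - A‖ ≤ δ) (hlam : 2 * δ < lam) :
    ‖(1 - U * Uᵀ) * B‖ ≤ δ := by
  have hδ0 : 0 ≤ δ := (norm_nonneg _).trans hδ
  obtain ⟨hU1, hU2⟩ := hU
  -- By Weyl, the retained singular values of `B` are at least `lam` - δ, which exceeds δ.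
  have hσ : ∀ k : Fin r, δ < singVal B k := by
    intro k
    have h1 := singVal_le_add A B (r - 1)
    have h2 : singVal B (r - 1) ≤ singVal B k :=
      (toEuclideanLin B).singularValues_antitone (by omega)
    rw [← norm_neg, neg_sub] at h1
    linarith
  have hBt := mul_transpose_mul_leading ⟨hU1, hU2⟩
  have key : ∀ v : p → ℝ, Uᵀ *ᵥ v = 0 → (Bᵀ *ᵥ v) ⬝ᵥ (Bᵀ *ᵥ v) ≤ δ ^ 2 * (v ⬝ᵥ v) := by
    intro v hv
    -- The parameters of U x + β v form a space of dimension r + 1, while Aᵀ has rank at most r. So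
    -- some non-zero choice gives a `w` with Aᵀ w = 0, on which Bᵀ acts as (B - A)ᵀ and stretches by
    -- at most δ.
    let f : ((Fin r → ℝ) × ℝ) →ₗ[ℝ] (p → ℝ) :=
      U.mulVecLin.coprod (LinearMap.toSpanSingleton ℝ _ v)
    let g : ((Fin r → ℝ) × ℝ) →ₗ[ℝ] LinearMap.range Aᵀ.mulVecLin := Aᵀ.mulVecLin.rangeRestrict ∘ₗ f
    have hg : LinearMap.ker g ≠ ⊥ := by
      refine LinearMap.ker_ne_bot_of_finrank_lt ?_
      have : Module.finrank ℝ (LinearMap.range Aᵀ.mulVecLin) = A.rank := by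
        rw [← Matrix.rank_transpose A]; rfl
      rw [this]
      simp
      omega
    obtain ⟨⟨x, β⟩, hx, hx0⟩ := Submodule.exists_mem_ne_zero_of_ne_bot hg
    have hAf : Aᵀ *ᵥ (U *ᵥ x + β • v) = 0 := by
      have := congrArg Subtype.val (LinearMap.mem_ker.1 hx)
      exact this
    set w := U *ᵥ x + β • v with hw
    have e1 : w ⬝ᵥ w = x ⬝ᵥ x + β ^ 2 * (v ⬝ᵥ v) := by
      have h1 : (U *ᵥ x) ⬝ᵥ (U *ᵥ x) = x ⬝ᵥ x := by
        rw [dotProduct_mulVec, vecMul_mulVec, hU1, vecMul_one]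
      have h2 : (U *ᵥ x) ⬝ᵥ v = 0 := by
        rw [dotProduct_comm, dotProduct_mulVec, ← mulVec_transpose, hv, zero_dotProduct]
      have h3 : v ⬝ᵥ (U *ᵥ x) = 0 := by rw [dotProduct_comm, h2]
      simp only [hw, add_dotProduct, dotProduct_add, smul_dotProduct, dotProduct_smul, h1, h2, h3,
        smul_eq_mul]
      ring
    have e2 : (Bᵀ *ᵥ w) ⬝ᵥ (Bᵀ *ᵥ w) =
        ∑ k : Fin r, singVal B k ^ 2 * x k ^ 2 + β ^ 2 * ((Bᵀ *ᵥ v) ⬝ᵥ (Bᵀ *ᵥ v)) := by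
      have hB : ∀ a b : p → ℝ, (Bᵀ *ᵥ a) ⬝ᵥ (Bᵀ *ᵥ b) = a ⬝ᵥ ((B * Bᵀ) *ᵥ b) := by
        intro a b
        rw [← mulVec_mulVec, dotProduct_mulVec a, ← mulVec_transpose]
      have hBU : (B * Bᵀ) *ᵥ (U *ᵥ x) = U *ᵥ (fun k => singVal B k ^ 2 * x k) := by
        rw [mulVec_mulVec, hBt, ← mulVec_mulVec]
        congr 1
        ext k
        rw [mulVec_diagonal]
      have h1 : (Bᵀ *ᵥ (U *ᵥ x)) ⬝ᵥ (Bᵀ *ᵥ (U *ᵥ x)) = ∑ k : Fin r, singVal B k ^ 2 * x k ^ 2 := by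
        rw [hB, hBU, dotProduct_mulVec, vecMul_mulVec, hU1, vecMul_one, dotProduct]
        exact Finset.sum_congr rfl fun k _ => by ring
      have h2 : (Bᵀ *ᵥ v) ⬝ᵥ (Bᵀ *ᵥ (U *ᵥ x)) = 0 := by
        rw [hB, hBU, dotProduct_mulVec, ← mulVec_transpose, hv, zero_dotProduct]
      have h3 : (Bᵀ *ᵥ (U *ᵥ x)) ⬝ᵥ (Bᵀ *ᵥ v) = 0 := by rw [dotProduct_comm, h2]
      simp only [hw, mulVec_add, mulVec_smul, add_dotProduct, dotProduct_add, smul_dotProduct,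
        dotProduct_smul, h1, h2, h3, smul_eq_mul]
      ring
    have e3 : (Bᵀ *ᵥ w) ⬝ᵥ (Bᵀ *ᵥ w) ≤ δ ^ 2 * (w ⬝ᵥ w) := by
      have h1 : Bᵀ *ᵥ w = (B - A)ᵀ *ᵥ w := by
        rw [transpose_sub, sub_mulVec, hAf, sub_zero]
      rw [h1]
      refine (dotProduct_mulVec_self_le _ _).trans ?_
      rw [opNorm_transpose]
      have : 0 ≤ w ⬝ᵥ w := Finset.sum_nonneg fun i _ => mul_self_nonneg (w i)
      gcongr
    rw [e1, e2] at e3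
    have e4 : δ ^ 2 * (x ⬝ᵥ x) ≤ ∑ k : Fin r, singVal B k ^ 2 * x k ^ 2 := by
      rw [dotProduct, Finset.mul_sum]
      refine Finset.sum_le_sum fun k _ => ?_
      rw [← sq]
      have := hσ k
      gcongr
    -- All U-directions are stretched by more than δ, so `w` must involve `v`, and it is `v` that
    -- keeps the stretch of `w` down to δ.
    by_cases hβ : β = 0
    · exfalso
      subst hβ
      have hxne : x ≠ 0 := fun h => hx0 (by simp [h])
      obtain ⟨k, hk⟩ := Function.ne_iff.1 hxne
      have : δ ^ 2 * (x ⬝ᵥ x) < ∑ k : Fin r, singVal B k ^ 2 * x k ^ 2 := by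
        rw [dotProduct, Finset.mul_sum]
        refine Finset.sum_lt_sum (fun k _ => ?_) ⟨k, Finset.mem_univ _, ?_⟩
        · rw [← sq]
          have := hσ k
          gcongr
        · rw [← sq]
          have := hσ k
          have h0 : x k ≠ 0 := hk
          have : 0 < x k ^ 2 := by positivity
          gcongr
      simp at e3
      linarith
    · have : 0 < β ^ 2 := by positivity
      nlinarith
  have hP : (U * Uᵀ)ᵀ = U * Uᵀ := by simp
  have hP2 : U * Uᵀ * (U * Uᵀ) = U * Uᵀ := by
    rw [Matrix.mul_assoc, ← Matrix.mul_assoc Uᵀ, hU1, Matrix.one_mul]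
  obtain ⟨hQ, hQ2⟩ := compl_proj hP hP2
  rw [← opNorm_transpose, transpose_mul, hQ]
  refine opNorm_le_of_dotProduct _ hδ0 fun y => ?_
  rw [← mulVec_mulVec]
  refine (key _ ?_).trans ?_
  · rw [mulVec_mulVec, Matrix.mul_sub, ← Matrix.mul_assoc, hU1]
    simp
  · have h1 := dotProduct_mulVec_self_le (1 - U * Uᵀ) y
    have h2 := opNorm_le_one_of_proj hQ hQ2
    have h3 : ‖1 - U * Uᵀ‖ ^ 2 ≤ 1 := pow_le_one₀ (norm_nonneg _) h2
    have h4 : 0 ≤ y ⬝ᵥ y := Finset.sum_nonneg fun i _ => mul_self_nonneg (y i)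
    have : ((1 - U * Uᵀ) *ᵥ y) ⬝ᵥ ((1 - U * Uᵀ) *ᵥ y) ≤ y ⬝ᵥ y := by nlinarith
    gcongr

/-- If the non-zero singular values of `A` are at least `lam`, then `F` maps the range of `A` with
norm at most `‖F * A‖ / lam`. -/
theorem fro_mul_mul_le [DecidableEq p] [DecidableEq q] {A : Matrix p q ℝ} {r : ℕ}
    {lam : ℝ} (hlam : 0 < lam) (hA : lam ≤ singVal A (r - 1)) (hr : A.rank ≤ r)
    (F : Matrix s p ℝ) (Z : Matrix q t ℝ) :
    fro (F * A * Z) ≤ ‖F * A‖ / lam * fro (A * Z) := by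
  obtain ⟨B, hB, hB'⟩ := exists_matrix_bounded_inverse hlam hA hr
  have : F * A * Z = F * A * B * (A * Z) := by
    conv_lhs => rw [← hB]
    simp only [Matrix.mul_assoc]
  rw [this, div_eq_mul_inv]
  refine (fro_mul_le _ _).trans (mul_le_mul_of_nonneg_right ?_ (fro_nonneg _))
  exact (l2_opNorm_mul _ _).trans (mul_le_mul_of_nonneg_left hB' (norm_nonneg _))

/-- Inserting the generalized inverse of `A` moves a factor Aᵀ onto `Y`. In the application the
product Y Aᵀ is of second order, which Cauchy–Schwarz on the original pairing would not see. -/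
theorem abs_ip_mul_le [DecidableEq p] [DecidableEq q] {A : Matrix p q ℝ} {r : ℕ}
    {lam : ℝ} (hlam : 0 < lam) (hA : lam ≤ singVal A (r - 1)) (hr : A.rank ≤ r)
    (F : Matrix s p ℝ) (Y : Matrix s q ℝ) :
    |ip (F * A) Y| ≤ fro (F * A) / lam * fro (Y * Aᵀ) := by
  obtain ⟨B, hB, hB'⟩ := exists_matrix_bounded_inverse hlam hA hr
  have : F * A = F * A * B * A := by
    conv_lhs => rw [← hB]
    simp only [Matrix.mul_assoc]
  conv_lhs => rw [this, ip_mul_right]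
  refine (abs_ip_le _ _).trans (mul_le_mul_of_nonneg_right ?_ (fro_nonneg _))
  rw [div_eq_mul_inv]
  exact (fro_mul_le' _ _).trans (mul_le_mul_of_nonneg_left hB' (fro_nonneg _))

end Matrices

/-! ### Multilinear products, matricizations, and projections switched on mode by mode. -/

section Tensors

open Matrix

variable {m : ℕ} {d e g : Fin m → ℕ}

theorem multiMul_multiMul (T : Tensor d) (A : (j : Fin m) → Matrix (Fin (e j)) (Fin (d j)) ℝ)
    (B : (j : Fin m) → Matrix (Fin (g j)) (Fin (e j)) ℝ) :
    multiMul (multiMul T A) B = multiMul T fun j => B j * A j := by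
  ext i
  simp only [multiMul, Matrix.mul_apply]
  simp_rw [Finset.prod_univ_sum, Fintype.piFinset_univ, Finset.sum_mul, Finset.mul_sum]
  rw [Finset.sum_comm]
  refine Finset.sum_congr rfl fun k _ => Finset.sum_congr rfl fun l _ => ?_
  rw [Finset.prod_mul_distrib]
  ring

theorem multiMul_one (T : Tensor d) : multiMul T (fun j => (1 : Matrix (Fin (d j)) _ ℝ)) = T := by
  ext i
  simp only [multiMul]
  rw [Finset.sum_eq_single i]
  · simp
  · intro k _ hk
    obtain ⟨j, hj⟩ := Function.ne_iff.1 hk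
    have h0 : ∏ j, (1 : Matrix (Fin (d j)) (Fin (d j)) ℝ) (i j) (k j) = 0 :=
      Finset.prod_eq_zero (Finset.mem_univ j) (Matrix.one_apply_ne (Ne.symm hj))
    exact (congrArg (T k * ·) h0).trans (mul_zero _)
  · simp

theorem multiMul_sub (T S : Tensor d) (A : (j : Fin m) → Matrix (Fin (e j)) (Fin (d j)) ℝ) :
    multiMul (T - S) A = multiMul T A - multiMul S A := by
  ext i
  simp [multiMul, sub_mul, Finset.sum_sub_distrib]

theorem inner_multiMul (T : Tensor d) (A : (j : Fin m) → Matrix (Fin (e j)) (Fin (d j)) ℝ)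
    (S : Tensor e) : inner ℝ (multiMul T A) S = inner ℝ T (multiMul S fun j => (A j)ᵀ) := by
  simp only [PiLp.inner_apply, multiMul, transpose_apply, RCLike.inner_apply, conj_trivial,
    Finset.mul_sum, Finset.sum_mul]
  rw [Finset.sum_comm]
  exact Finset.sum_congr rfl fun i _ => Finset.sum_congr rfl fun k _ => by ring

@[simp]
theorem glue_self (j : Fin m) (a : Fin (d j)) (b : (k : {k : Fin m // k ≠ j}) → Fin (d k)) :
    glue j a b j = a := by
  simp [glue, Equiv.piSplitAt]

@[simp]
theorem glue_ne (j : Fin m) (a : Fin (d j)) (b : (k : {k : Fin m // k ≠ j}) → Fin (d k))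
    (k : {k : Fin m // k ≠ j}) : glue j a b k = b k := by
  simp [glue, Equiv.piSplitAt, k.2]

theorem sum_glue {M : Type*} [AddCommMonoid M] (j : Fin m) (f : ((k : Fin m) → Fin (d k)) → M) :
    ∑ i, f i = ∑ a, ∑ b, f (glue j a b) := by
  rw [← (Equiv.piSplitAt j fun k => Fin (d k)).symm.sum_comp, Fintype.sum_prod_type]
  rfl

theorem prod_glue (j : Fin m) (f : Fin m → ℝ) :
    ∏ k, f k = f j * ∏ k : {k : Fin m // k ≠ j}, f k := by
  rw [← Finset.mul_prod_erase _ _ (Finset.mem_univ j)]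
  congr 1
  exact Finset.prod_subtype _ (by simp) _

theorem inner_eq_ip_unfold (T S : Tensor d) (j : Fin m) :
    inner ℝ T S = ip (unfold T j) (unfold S j) := by
  rw [ip_eq_sum, PiLp.inner_apply, sum_glue j]
  simp [unfold, mul_comm]

theorem norm_eq_fro_unfold (T : Tensor d) (j : Fin m) : ‖T‖ = fro (unfold T j) := by
  rw [fro, ← inner_eq_ip_unfold, real_inner_self_eq_norm_sq, Real.sqrt_sq (norm_nonneg _)]

theorem unfold_add (T S : Tensor d) (j : Fin m) : unfold (T + S) j = unfold T j + unfold S j := by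
  ext; simp [unfold]

theorem unfold_sub (T S : Tensor d) (j : Fin m) : unfold (T - S) j = unfold T j - unfold S j := by
  ext; simp [unfold]

theorem unfold_sum {ι : Type*} (s : Finset ι) (T : ι → Tensor d) (j : Fin m) :
    unfold (∑ i ∈ s, T i) j = ∑ i ∈ s, unfold (T i) j := by
  ext; simp [unfold, Matrix.sum_apply]

theorem unfold_multiMul (T : Tensor d) (A : (j : Fin m) → Matrix (Fin (e j)) (Fin (d j)) ℝ)
    (j : Fin m) : unfold (multiMul T A) j = A j * unfold T j * (kronExcept A j)ᵀ := by
  ext a b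
  simp only [unfold, multiMul, kronExcept, Matrix.mul_apply, of_apply, transpose_apply,
    Finset.sum_mul]
  rw [sum_glue j, Finset.sum_comm]
  refine Finset.sum_congr rfl fun c _ => Finset.sum_congr rfl fun x _ => ?_
  rw [prod_glue j]
  simp
  ring

theorem kronExcept_mul (A : (j : Fin m) → Matrix (Fin (e j)) (Fin (d j)) ℝ)
    (B : (j : Fin m) → Matrix (Fin (g j)) (Fin (e j)) ℝ) (j : Fin m) :
    kronExcept B j * kronExcept A j = kronExcept (fun k => B k * A k) j := by
  ext a b
  simp only [kronExcept, Matrix.mul_apply, of_apply]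
  simp_rw [Finset.prod_univ_sum, Fintype.piFinset_univ, Finset.prod_mul_distrib]

theorem kronExcept_transpose (A : (j : Fin m) → Matrix (Fin (e j)) (Fin (d j)) ℝ) (j : Fin m) :
    (kronExcept A j)ᵀ = kronExcept (fun k => (A k)ᵀ) j := rfl

theorem kronExcept_congr {A B : (j : Fin m) → Matrix (Fin (e j)) (Fin (d j)) ℝ} {j : Fin m}
    (h : ∀ k ≠ j, A k = B k) : kronExcept A j = kronExcept B j := by
  ext a b
  simp only [kronExcept, of_apply]
  exact Finset.prod_congr rfl fun k _ => by rw [h k k.2]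

theorem kronExcept_one (j : Fin m) :
    kronExcept (fun k => (1 : Matrix (Fin (d k)) (Fin (d k)) ℝ)) j = 1 := by
  ext a b
  simp only [kronExcept, of_apply]
  by_cases h : a = b
  · subst h; simp
  · rw [Matrix.one_apply_ne h]
    obtain ⟨k, hk⟩ := Function.ne_iff.1 h
    exact Finset.prod_eq_zero (Finset.mem_univ k) (Matrix.one_apply_ne hk)

theorem rank_unfold_multiMul_le (T : Tensor d)
    (A : (j : Fin m) → Matrix (Fin (e j)) (Fin (d j)) ℝ) (j : Fin m) :
    (unfold (multiMul T A) j).rank ≤ (A j).rank := by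
  rw [unfold_multiMul]
  exact (rank_mul_le_left _ _).trans (rank_mul_le_left _ _)

theorem multiMul_mem_tuckerSet (T : Tensor d)
    (A : (j : Fin m) → Matrix (Fin (e j)) (Fin (d j)) ℝ) : multiMul T A ∈ tuckerSet e d := fun j =>
  (rank_unfold_multiMul_le T A j).trans ((A j).rank_le_width)

/-- A family of orthogonal projections, one for each mode. -/
structure IsProjFamily (P : (j : Fin m) → Matrix (Fin (d j)) (Fin (d j)) ℝ) : Prop where
  symm : ∀ j, (P j)ᵀ = P j
  idem : ∀ j, P j * P j = P j

theorem isProjFamily_of_orthonormal {U : (j : Fin m) → Matrix (Fin (d j)) (Fin (e j)) ℝ}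
    (hU : ∀ j, (U j)ᵀ * U j = 1) : IsProjFamily fun j => U j * (U j)ᵀ where
  symm j := by simp
  idem j := by rw [Matrix.mul_assoc, ← Matrix.mul_assoc (U j)ᵀ, hU, Matrix.one_mul]

namespace IsProjFamily

variable {P : (j : Fin m) → Matrix (Fin (d j)) (Fin (d j)) ℝ}

theorem inner_multiMul (hP : IsProjFamily P) (T S : Tensor d) :
    inner ℝ (multiMul T P) S = inner ℝ T (multiMul S P) := by
  rw [TensorRsGrad.inner_multiMul]
  simp only [hP.symm]

theorem multiMul_multiMul (hP : IsProjFamily P) (T : Tensor d) :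
    multiMul (multiMul T P) P = multiMul T P := by
  rw [TensorRsGrad.multiMul_multiMul]
  simp only [hP.idem]

theorem norm_sub_sq (hP : IsProjFamily P) (T : Tensor d) :
    ‖T - multiMul T P‖ ^ 2 = ‖T‖ ^ 2 - ‖multiMul T P‖ ^ 2 := by
  have h : inner ℝ T (multiMul T P) = ‖multiMul T P‖ ^ 2 := by
    rw [← real_inner_self_eq_norm_sq, hP.inner_multiMul, hP.multiMul_multiMul]
  rw [norm_sub_sq_real, h]
  ring

theorem norm_multiMul_le (hP : IsProjFamily P) (T : Tensor d) : ‖multiMul T P‖ ≤ ‖T‖ := by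
  refine le_of_sq_le_sq ?_ (norm_nonneg _)
  have := hP.norm_sub_sq T
  nlinarith [sq_nonneg ‖T - multiMul T P‖]

theorem norm_sub_multiMul_le (hP : IsProjFamily P) (T : Tensor d) : ‖T - multiMul T P‖ ≤ ‖T‖ := by
  refine le_of_sq_le_sq ?_ (norm_nonneg _)
  have := hP.norm_sub_sq T
  nlinarith [sq_nonneg ‖multiMul T P‖]

theorem kronExcept_symm (hP : IsProjFamily P) (j : Fin m) : (kronExcept P j)ᵀ = kronExcept P j := by
  rw [kronExcept_transpose]
  simp only [hP.symm]

end IsProjFamily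

/-- The projections of a family for the modes in `S`, the identity for the others. -/
def restrictModes (P : (j : Fin m) → Matrix (Fin (d j)) (Fin (d j)) ℝ) (S : Finset (Fin m))
    (j : Fin m) : Matrix (Fin (d j)) (Fin (d j)) ℝ := if j ∈ S then P j else 1

theorem IsProjFamily.restrictModes {P : (j : Fin m) → Matrix (Fin (d j)) (Fin (d j)) ℝ}
    (hP : IsProjFamily P) (S : Finset (Fin m)) : IsProjFamily (restrictModes P S) where
  symm j := by
    by_cases h : j ∈ S <;> simp [TensorRsGrad.restrictModes, h, hP.symm]
  idem j := by
    by_cases h : j ∈ S <;> simp [TensorRsGrad.restrictModes, h, hP.idem]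

theorem restrictModes_empty (P : (j : Fin m) → Matrix (Fin (d j)) (Fin (d j)) ℝ) :
    restrictModes P ∅ = fun _ => 1 := by
  funext j; simp [restrictModes]

theorem restrictModes_univ (P : (j : Fin m) → Matrix (Fin (d j)) (Fin (d j)) ℝ) :
    restrictModes P Finset.univ = P := by
  funext j; simp [restrictModes]

/-- Passing from `S` to `insert i S` removes a component that the `i`-th projection annihilates. -/
theorem unfold_restrictModes_sub {P : (j : Fin m) → Matrix (Fin (d j)) (Fin (d j)) ℝ}
    (S : Finset (Fin m)) {i : Fin m} (hi : i ∉ S) (T : Tensor d) :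
    unfold (multiMul T (restrictModes P S) - multiMul T (restrictModes P (insert i S))) i =
      (1 - P i) * unfold T i * (kronExcept (restrictModes P S) i)ᵀ := by
  have h : kronExcept (restrictModes P (insert i S)) i = kronExcept (restrictModes P S) i :=
    kronExcept_congr fun k hk => by simp [restrictModes, hk]
  rw [unfold_sub, unfold_multiMul, unfold_multiMul, h]
  simp [restrictModes, hi, Matrix.sub_mul]

/-- Since mode `i` is still untouched, the discarded part is a right multiple of the `i`-th
matricization, the form to which a generalized inverse can be applied. -/
theorem unfold_sub_restrictModes {P : (j : Fin m) → Matrix (Fin (d j)) (Fin (d j)) ℝ}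
    (S : Finset (Fin m)) {i : Fin m} (hi : i ∉ S) (T : Tensor d) :
    unfold (T - multiMul T (restrictModes P S)) i =
      unfold T i * (1 - (kronExcept (restrictModes P S) i)ᵀ) := by
  rw [unfold_sub, unfold_multiMul]
  simp [restrictModes, hi, Matrix.mul_sub]

end Tensors

/-! ### The truncated norm as a dual norm on tensors of low Tucker rank. -/

section TruncNorm

open Matrix

/-- A matrix of rank at most `s` is fixed by the projection onto the span of `min s d` orthonormal
vectors. -/
theorem exists_orthonormal_columns {d s : ℕ} {q : Type*} [Fintype q] (A : Matrix (Fin d) q ℝ)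
    (hA : A.rank ≤ s) :
    ∃ V : Matrix (Fin d) (Fin (min s d)) ℝ, Vᵀ * V = 1 ∧ V * Vᵀ * A = A := by
  classical
  set R := LinearMap.range (toEuclideanLin A) with hR
  set ρ := Module.finrank ℝ R with hρ
  have hρA : ρ = A.rank := finrank_range_toEuclideanLin A
  have hρd : ρ ≤ d := hρA.trans_le (A.rank_le_card_height.trans (by simp))
  have hρn : ρ ≤ min s d := le_min (hρA.trans_le hA) hρd
  let bR := stdOrthonormalBasis ℝ R
  -- The zeros are placeholders: orthonormality is required only on the indices below ρ, and the
  -- extension to a basis overwrites the rest.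
  let v : Fin d → EuclideanSpace ℝ (Fin d) := fun i => if h : (i : ℕ) < ρ then bR ⟨i, h⟩ else 0
  have hv : Orthonormal ℝ (Set.domRestrict {i : Fin d | (i : ℕ) < ρ} v) := by
    have h1 := bR.orthonormal.comp_linearIsometry R.subtypeₗᵢ
    have h2 := h1.comp (fun i : {i : Fin d | (i : ℕ) < ρ} => (⟨i.1, i.2⟩ : Fin ρ))
      fun i j hij => by
        have := congrArg Fin.val hij
        exact Subtype.ext (Fin.ext this)
    convert h2 using 1
    funext i
    have : (i.1 : ℕ) < ρ := i.2
    exact dif_pos this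
  obtain ⟨b, hb⟩ := hv.exists_orthonormalBasis_extension_of_card_eq (by simp)
  let V : Matrix (Fin d) (Fin (min s d)) ℝ := of fun i k => b (Fin.castLE (min_le_right _ _) k) i
  have hV : Vᵀ * V = 1 := by
    ext k l
    have h := b.inner_eq_ite (Fin.castLE (min_le_right s d) l) (Fin.castLE (min_le_right s d) k)
    rw [PiLp.inner_apply] at h
    simp only [RCLike.inner_apply, conj_trivial] at h
    simp only [Matrix.mul_apply, transpose_apply, V, of_apply, h, Matrix.one_apply]
    simp [eq_comm]
  let Q : Matrix (Fin d) (Fin ρ) ℝ := of fun i k => (bR k : EuclideanSpace ℝ (Fin d)) i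
  have hQV : Q = V.submatrix id (Fin.castLE hρn) := by
    ext i k
    have h := hb (Fin.castLE hρd k) (by simp)
    simp only [Q, V, submatrix_apply, of_apply, id]
    have h2 : (Fin.castLE (min_le_right s d) (Fin.castLE hρn k)) = Fin.castLE hρd k := rfl
    rw [h2, h]
    simp [v]
  have hA2 : A = Q * (Qᵀ * A) := by
    ext i j
    have hx : toEuclideanLin A (WithLp.toLp 2 (Pi.single j 1)) ∈ R := LinearMap.mem_range_self _ _
    have h := bR.sum_repr' ⟨_, hx⟩
    have h2 := congrArg (fun y : R => (y : EuclideanSpace ℝ (Fin d)) i) h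
    have h3 : ∀ l, (toEuclideanLin A (WithLp.toLp 2 (Pi.single j 1))) l = A l j := by
      intro l
      simp
    simp only [AddSubmonoidClass.coe_finsetSum, Submodule.coe_smul, WithLp.ofLp_sum,
      Finset.sum_apply, WithLp.ofLp_smul, Pi.smul_apply, smul_eq_mul, Submodule.coe_inner,
      PiLp.inner_apply, h3, RCLike.inner_apply, conj_trivial] at h2
    rw [← h2]
    simp only [Matrix.mul_apply, transpose_apply, Q, of_apply]
    refine Finset.sum_congr rfl fun k _ => ?_
    rw [mul_comm]
    congr 1
    exact Finset.sum_congr rfl fun l _ => mul_comm _ _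
  refine ⟨V, hV, ?_⟩
  have hQ : V * Vᵀ * Q = Q := by
    have : V * Vᵀ * V = V := by rw [Matrix.mul_assoc, hV, Matrix.mul_one]
    rw [hQV]
    conv_rhs => rw [← this]
    rfl
  rw [hA2, ← Matrix.mul_assoc, hQ]

variable {m : ℕ} {d s : Fin m → ℕ}

/-- Switching on one more mode changes the tensor by something whose `i`-th matricization carries
the factor (1 - Pᵢ) Zᵢ = 0. -/
theorem multiMul_eq_self {Z : Tensor d} {P : (j : Fin m) → Matrix (Fin (d j)) (Fin (d j)) ℝ}
    (hP : ∀ j, P j * unfold Z j = unfold Z j) : multiMul Z P = Z := by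
  have key : ∀ S : Finset (Fin m), multiMul Z (restrictModes P S) = Z := by
    intro S
    induction S using Finset.induction_on with
    | empty => rw [restrictModes_empty, multiMul_one]
    | insert i S hi ih =>
      have h := unfold_restrictModes_sub (P := P) S hi Z
      rw [Matrix.sub_mul, hP, Matrix.one_mul, sub_self, Matrix.zero_mul] at h
      have h2 := norm_eq_fro_unfold
        (multiMul Z (restrictModes P S) - multiMul Z (restrictModes P (insert i S))) i
      rw [h] at h2
      have h3 : fro (0 : Matrix (Fin (d i)) ((k : {k : Fin m // k ≠ i}) → Fin (d k)) ℝ) = 0 := by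
        simp [fro, ip]
      rw [h3, norm_eq_zero, sub_eq_zero, ih] at h2
      exact h2.symm
  have := key Finset.univ
  rwa [restrictModes_univ] at this

theorem norm_multiMul_transpose_le {e : Fin m → ℕ}
    {U : (j : Fin m) → Matrix (Fin (d j)) (Fin (e j)) ℝ} (hU : ∀ j, (U j)ᵀ * U j = 1)
    (G : Tensor d) : ‖multiMul G fun j => (U j)ᵀ‖ ≤ ‖G‖ := by
  have hP := isProjFamily_of_orthonormal hU
  have h : ‖multiMul G fun j => (U j)ᵀ‖ ^ 2 = ‖multiMul G fun j => U j * (U j)ᵀ‖ ^ 2 := by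
    rw [← real_inner_self_eq_norm_sq, ← real_inner_self_eq_norm_sq, hP.inner_multiMul,
      hP.multiMul_multiMul, inner_multiMul, multiMul_multiMul]
    simp
  refine le_of_sq_le_sq ?_ (norm_nonneg _)
  rw [h]
  exact pow_le_pow_left₀ (norm_nonneg _) (hP.norm_multiMul_le G) 2

/-- The truncated Frobenius norm bounds the pairing with tensors of low Tucker rank. -/
theorem inner_le_truncNorm (G : Tensor d) {Z : Tensor d} (hZ : Z ∈ tuckerSet d s) :
    inner ℝ G Z ≤ truncNorm s G * ‖Z‖ := by
  choose V hV hVZ using fun j => exists_orthonormal_columns (unfold Z j) (hZ j)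
  have h1 : multiMul Z (fun j => V j * (V j)ᵀ) = Z := multiMul_eq_self hVZ
  have h2 : inner ℝ G Z = inner ℝ (multiMul G fun j => (V j)ᵀ) (multiMul Z fun j => (V j)ᵀ) := by
    rw [inner_multiMul, multiMul_multiMul]
    simp only [transpose_transpose]
    rw [h1]
  have h3 : ‖multiMul G fun j => (V j)ᵀ‖ ≤ truncNorm s G := by
    refine le_csSup ⟨‖G‖, ?_⟩ ⟨V, hV, rfl⟩
    rintro x ⟨U, hU, rfl⟩
    exact norm_multiMul_transpose_le hU G
  rw [h2]
  refine (real_inner_le_norm _ _).trans ?_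
  exact mul_le_mul h3 (norm_multiMul_transpose_le hV Z) (norm_nonneg _) ((norm_nonneg _).trans h3)

theorem tuckerSet_mono {r : Fin m → ℕ} (h : ∀ j, r j ≤ s j) {Z : Tensor d}
    (hZ : Z ∈ tuckerSet d r) : Z ∈ tuckerSet d s := fun j => (hZ j).trans (h j)

end TruncNorm

/-! ### Second-order perturbation bound for the truncated higher-order SVD. -/

section HOSVD

open Matrix
open scoped Matrix.Norms.L2Operator

/-- The pairing of a low-rank matrix `A` with the part of a perturbation `B` of it that is discarded
in the truncated singular value decomposition, after projecting the columns. -/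
theorem ip_compl_leading_le {p q : Type*} [Fintype p] [Fintype q] [DecidableEq p] [DecidableEq q]
    {r : ℕ} {A B : Matrix p q ℝ} {U : Matrix p (Fin r) ℝ} (hU : IsLeadingLeftSingular B U)
    (hr : A.rank ≤ r) {lam δ ν : ℝ} (hA : lam ≤ singVal A (r - 1)) (hδ : fro (B - A) ≤ δ)
    (hlam : 2 * δ < lam) {K : Matrix q q ℝ} (hK : Kᵀ = K)
    (hB : fro ((1 - U * Uᵀ) * B) ≤ ν) (hAK : fro (A * (1 - K)) ≤ δ + ν) :
    ip A ((1 - U * Uᵀ) * B * K) ≤ 4 * (δ / lam) * (δ + ν) * ν := by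
  have hδ0 : 0 ≤ δ := (fro_nonneg _).trans hδ
  have hlam0 : 0 < lam := by linarith
  have hν0 : 0 ≤ ν := (fro_nonneg _).trans hB
  have hop : ‖B - A‖ ≤ δ := (opNorm_le_fro _).trans hδ
  have hP : (U * Uᵀ)ᵀ = U * Uᵀ := by simp
  have hP2 : U * Uᵀ * (U * Uᵀ) = U * Uᵀ := by
    rw [Matrix.mul_assoc, ← Matrix.mul_assoc Uᵀ, hU.1, Matrix.one_mul]
  obtain ⟨hF, hF2⟩ := compl_proj hP hP2
  have hFB : ‖(1 - U * Uᵀ) * B‖ ≤ δ := opNorm_compl_leading_le hU hr hA hop hlam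
  have hcomm := compl_leading_mul hU
  set F := 1 - U * Uᵀ
  -- `F` is idempotent, so it can be put on both sides. In the first pairing smallness comes from
  -- the singular vector relation for `B`, in the second from `A * (1 - K)` being small.
  have hsplit : ip A (F * B * K) = ip (F * A) (F * B) - ip (F * A * (1 - K)) (F * B) := by
    have h1 : F * B * K = F * (F * B * K) := by rw [← Matrix.mul_assoc, ← Matrix.mul_assoc, hF2]
    rw [h1, ip_comm, ip_mul_left, hF, ip_mul_right, hK, ip_comm (F * A) (F * B),
      ip_comm (F * A * (1 - K)), ← ip_sub_right, Matrix.mul_sub (F * A), Matrix.mul_one,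
      sub_sub_cancel]
  have hFA : fro (F * A) ≤ δ + ν := by
    have : F * A = F * B - F * (B - A) := by rw [Matrix.mul_sub]; abel
    rw [this]
    have h1 := fro_sub_le (F * B) (F * (B - A))
    have h2 := fro_proj_mul_le hF hF2 (B - A)
    linarith
  have hFAop : ‖F * A‖ ≤ 2 * δ := by
    have : F * A = F * B - F * (B - A) := by rw [Matrix.mul_sub]; abel
    rw [this]
    have h1 := norm_sub_le (F * B) (F * (B - A))
    have h2 := opNorm_proj_mul_le hF hF2 (B - A)
    linarith
  have t1 : |ip (F * A) (F * B)| ≤ (δ + ν) / lam * (2 * δ * ν) := by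
    refine (abs_ip_mul_le hlam0 hA hr F (F * B)).trans ?_
    refine mul_le_mul (by gcongr) ?_ (fro_nonneg _) (by positivity)
    -- Because `F` commutes with B Bᵀ, the term F B Bᵀ equals (F B)(F B)ᵀ, a product of two small
    -- factors.
    have : F * B * Aᵀ = F * B * (F * B)ᵀ - F * B * (B - A)ᵀ := by
      rw [hcomm, transpose_sub, Matrix.mul_sub]; abel
    rw [this]
    refine (fro_sub_le _ _).trans ?_
    have h1 := fro_mul_le' (F * B) (F * B)ᵀ
    have h2 := fro_mul_le' (F * B) (B - A)ᵀ
    rw [opNorm_transpose] at h1 h2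
    have h3 : fro (F * B) * ‖F * B‖ ≤ ν * δ := by gcongr
    have h4 : fro (F * B) * ‖B - A‖ ≤ ν * δ := by gcongr
    linarith
  have t2 : |ip (F * A * (1 - K)) (F * B)| ≤ 2 * δ / lam * (δ + ν) * ν := by
    refine (abs_ip_le _ _).trans ?_
    refine mul_le_mul ?_ hB (fro_nonneg _) (by positivity)
    refine (fro_mul_mul_le hlam0 hA hr F (1 - K)).trans ?_
    have := fro_nonneg (A * (1 - K))
    gcongr
  rw [hsplit]
  have e : 4 * (δ / lam) * (δ + ν) * ν =
      (δ + ν) / lam * (2 * δ * ν) + 2 * δ / lam * (δ + ν) * ν := by ring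
  rw [e]
  have a1 := (abs_le.1 t1).2
  have a2 := (abs_le.1 t2).1
  linarith

variable {m : ℕ} {d r : Fin m → ℕ}

/-- Perturbation bound for the truncated higher-order singular value decomposition, with a
second-order term that improves on the triangle inequality. -/
theorem norm_hosvd_sub_sq_le {Mstar T T' : Tensor d} (hM : Mstar ∈ tuckerSet d r)
    (h : IsHOSVD r T T') {lam δ : ℝ} (hlam0 : 0 < lam)
    (hlam : ∀ j, lam ≤ singVal (unfold Mstar j) (r j - 1)) (hm : 1 ≤ m)
    (hδ : ‖T - Mstar‖ ≤ δ) (hsmall : 16 * m * δ ≤ lam) :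
    ‖T' - Mstar‖ ^ 2 ≤ ‖T - Mstar‖ ^ 2 + 32 * (m * (δ / lam)) ^ 2 * δ ^ 2 := by
  obtain ⟨U, hU, rfl⟩ := h
  have hδ0 : 0 ≤ δ := (norm_nonneg _).trans hδ
  have hm1 : (1 : ℝ) ≤ m := by exact_mod_cast hm
  have h2δ : 2 * δ < lam := by nlinarith
  have hP : IsProjFamily fun j => U j * (U j)ᵀ := isProjFamily_of_orthonormal fun j => (hU j).1
  set P : (j : Fin m) → Matrix (Fin (d j)) (Fin (d j)) ℝ := fun j => U j * (U j)ᵀ with hPdef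
  set N := T - multiMul T P with hN
  set ν := ‖N‖
  -- The discarded part `N` telescopes over the modes; this bounds the pairing of one increment with
  -- `Mstar`.
  have hstep : ∀ (S : Finset (Fin m)) (i : Fin m), i ∉ S →
      inner ℝ Mstar (multiMul T (restrictModes P S) - multiMul T (restrictModes P (insert i S))) ≤
        4 * (δ / lam) * (δ + ν) * ν := by
    intro S i hi
    have hS := hP.restrictModes S
    rw [inner_eq_ip_unfold _ _ i, unfold_restrictModes_sub S hi, hS.kronExcept_symm]
    refine ip_compl_leading_le (hU i) (hM i) (hlam i) ?_ h2δ (hS.kronExcept_symm i) ?_ ?_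
    · rwa [← unfold_sub, ← norm_eq_fro_unfold]
    · have h1 : (1 - U i * (U i)ᵀ) * unfold T i = (1 - U i * (U i)ᵀ) * unfold N i := by
        rw [hN, unfold_sub, unfold_multiMul, Matrix.mul_sub, ← Matrix.mul_assoc,
          ← Matrix.mul_assoc, Matrix.sub_mul 1 _ (P i), Matrix.one_mul, hP.idem]
        simp
      have h2 := compl_proj (hP.symm i) (hP.idem i)
      rw [h1]
      refine (fro_proj_mul_le h2.1 h2.2 _).trans_eq ?_
      exact (norm_eq_fro_unfold N i).symm
    · have h0 : unfold Mstar i * (1 - kronExcept (restrictModes P S) i) =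
          unfold (Mstar - multiMul Mstar (restrictModes P S)) i := by
        rw [unfold_sub_restrictModes S hi, hS.kronExcept_symm]
      rw [h0, ← norm_eq_fro_unfold]
      -- Mstar = T P + N - (T - Mstar), and the first summand is fixed by the projections of the
      -- modes in `S`. What they discard from `Mstar` therefore has norm at most ν + δ.
      have h1 : Mstar - multiMul Mstar (restrictModes P S) =
          (N - multiMul N (restrictModes P S)) -
            ((T - Mstar) - multiMul (T - Mstar) (restrictModes P S)) := by
        have h2 : multiMul (multiMul T P) (restrictModes P S) = multiMul T P := by
          rw [multiMul_multiMul]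
          congr 1
          funext j
          by_cases hj : j ∈ S <;> simp [restrictModes, hj, hP.idem]
        rw [hN, multiMul_sub, multiMul_sub, h2]
        abel
      rw [h1]
      refine (norm_sub_le _ _).trans ?_
      have h3 := hS.norm_sub_multiMul_le N
      have h4 := hS.norm_sub_multiMul_le (T - Mstar)
      linarith
  have hsum : ∀ S : Finset (Fin m),
      inner ℝ Mstar (T - multiMul T (restrictModes P S)) ≤
        S.card * (4 * (δ / lam) * (δ + ν) * ν) := by
    intro S
    induction S using Finset.induction_on with
    | empty => simp [restrictModes_empty, multiMul_one]
    | insert i S hi ih =>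
      have h1 := hstep S i hi
      rw [Finset.card_insert_of_notMem hi]
      have h2 : T - multiMul T (restrictModes P (insert i S)) =
          (T - multiMul T (restrictModes P S)) +
            (multiMul T (restrictModes P S) - multiMul T (restrictModes P (insert i S))) := by
        abel
      rw [h2, inner_add_right]
      push_cast
      linarith
  have hMN := hsum Finset.univ
  rw [restrictModes_univ, ← hN, Finset.card_univ, Fintype.card_fin] at hMN
  have hTN : inner ℝ T N = ν ^ 2 := by
    have h1 : inner ℝ (multiMul T P) N = 0 := by
      rw [hP.inner_multiMul, hN, multiMul_sub, hP.multiMul_multiMul, sub_self, inner_zero_right]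
    have h2 : T = N + multiMul T P := by rw [hN]; abel
    conv_lhs => rw [h2]
    rw [inner_add_left, h1, real_inner_self_eq_norm_sq, add_zero]
  -- The truncation is orthogonal, so ⟨T, N⟩ = ν². The resulting -ν² is what absorbs the first-order
  -- part of ⟨Mstar, N⟩.
  have hid : ‖multiMul T P - Mstar‖ ^ 2 = ‖T - Mstar‖ ^ 2 + 2 * inner ℝ Mstar N - ν ^ 2 := by
    have h1 : multiMul T P - Mstar = (T - Mstar) - N := by rw [hN]; abel
    rw [h1, norm_sub_sq_real, inner_sub_left, hTN]
    ring
  rw [hid]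
  set ε := m * (δ / lam) with hε
  have hε0 : 0 ≤ ε := by positivity
  have hε1 : 16 * ε ≤ 1 := by
    have : 16 * ε = 16 * m * δ / lam := by rw [hε]; ring
    rw [this, div_le_one hlam0]
    exact hsmall
  have hMN' : inner ℝ Mstar N ≤ 4 * ε * (δ + ν) * ν := by
    refine hMN.trans_eq ?_
    rw [hε]; ring
  have hν0 : 0 ≤ ν := norm_nonneg N
  -- With 16ε ≤ 1 the excess 8ε(δ + ν)ν - ν² is at most 8εδν - ν²/2, whose maximum 32ε²δ² is
  -- attained at ν = 8εδ.
  nlinarith [sq_nonneg (ν - 8 * ε * δ), mul_nonneg (sub_nonneg.2 hε1) (sq_nonneg ν)]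

end HOSVD

/-! ### The tangent projection: self-adjointness, size, and second-order accuracy. -/

section Tangent

open Matrix
open scoped Matrix.Norms.L2Operator

variable {m : ℕ} {d r : Fin m → ℕ}

theorem unfold_injective (j : Fin m) {T S : Tensor d} (h : unfold T j = unfold S j) : T = S := by
  have h1 := norm_eq_fro_unfold (T - S) j
  rw [unfold_sub, h, sub_self] at h1
  have h2 : fro (0 : Matrix (Fin (d j)) ((k : {k : Fin m // k ≠ j}) → Fin (d k)) ℝ) = 0 := by
    simp [fro, ip]
  rw [h2, norm_eq_zero, sub_eq_zero] at h1
  exact h1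

theorem matrix_rank_add_le {p q : Type*} [Fintype p] [Fintype q] (A B : Matrix p q ℝ) :
    (A + B).rank ≤ A.rank + B.rank := by
  have h : LinearMap.range (A + B).mulVecLin ≤
      LinearMap.range A.mulVecLin ⊔ LinearMap.range B.mulVecLin := by
    rintro _ ⟨x, rfl⟩
    rw [mulVecLin_add, LinearMap.add_apply]
    exact Submodule.add_mem_sup (LinearMap.mem_range_self _ x) (LinearMap.mem_range_self _ x)
  exact (Submodule.finrank_mono h).trans (Submodule.finrank_add_le_finrank_add_finrank _ _)

theorem truncNorm_nonneg (s : Fin m → ℕ) (G : Tensor d) : 0 ≤ truncNorm s G := by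
  refine Real.sSup_nonneg ?_
  rintro x ⟨U, _, rfl⟩
  exact norm_nonneg _

/-- The data of a Tucker decomposition with orthonormal factors and the pseudo-inverses of the
matricizations of its core. -/
structure IsTuckerFrame (C : Tensor r) (U : (j : Fin m) → Matrix (Fin (d j)) (Fin (r j)) ℝ)
    (R : (i : Fin m) → Matrix ((k : {k : Fin m // k ≠ i}) → Fin (r k)) (Fin (r i)) ℝ) : Prop where
  orth : ∀ j, (U j)ᵀ * U j = 1
  pinv : ∀ i, IsMoorePenrose (unfold C i) (R i)

/-- The `i`-th curved component of the tangent projection. -/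
noncomputable def tangentPart (C : Tensor r)
    (U : (j : Fin m) → Matrix (Fin (d j)) (Fin (r j)) ℝ)
    (R : (i : Fin m) → Matrix ((k : {k : Fin m // k ≠ i}) → Fin (r k)) (Fin (r i)) ℝ)
    (i : Fin m) (G : Tensor d) : Tensor d :=
  multiMul C (Function.update U i
    ((1 - U i * (U i).transpose) * unfold G i * kronExcept U i * R i))

/-- The projection onto the row space of the `i`-th matricization. -/
def rowProj (C : Tensor r) (U : (j : Fin m) → Matrix (Fin (d j)) (Fin (r j)) ℝ)
    (R : (i : Fin m) → Matrix ((k : {k : Fin m // k ≠ i}) → Fin (r k)) (Fin (r i)) ℝ)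
    (i : Fin m) : Matrix ((k : {k : Fin m // k ≠ i}) → Fin (d k))
      ((k : {k : Fin m // k ≠ i}) → Fin (d k)) ℝ :=
  kronExcept U i * (R i * unfold C i) * (kronExcept U i)ᵀ

/-- The tangent projection. -/
noncomputable def tangentProj (C : Tensor r)
    (U : (j : Fin m) → Matrix (Fin (d j)) (Fin (r j)) ℝ)
    (R : (i : Fin m) → Matrix ((k : {k : Fin m // k ≠ i}) → Fin (r k)) (Fin (r i)) ℝ)
    (G : Tensor d) : Tensor d :=
  multiMul G (fun j => U j * (U j).transpose) + ∑ i, tangentPart C U R i G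

theorem IsHOSVD.mem_tuckerSet {T T' : Tensor d} (h : IsHOSVD r T T') : T' ∈ tuckerSet d r := by
  obtain ⟨U, _, rfl⟩ := h
  intro j
  exact (rank_unfold_multiMul_le _ _ j).trans ((rank_mul_le_left _ _).trans (U j).rank_le_width)

namespace IsTuckerFrame

variable {C : Tensor r} {U : (j : Fin m) → Matrix (Fin (d j)) (Fin (r j)) ℝ}
  {R : (i : Fin m) → Matrix ((k : {k : Fin m // k ≠ i}) → Fin (r k)) (Fin (r i)) ℝ}

theorem unfold_tangentPart (i : Fin m) (G : Tensor d) :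
    unfold (tangentPart C U R i G) i =
      (1 - U i * (U i)ᵀ) * unfold G i * rowProj C U R i := by
  rw [tangentPart, unfold_multiMul, Function.update_self,
    kronExcept_congr (A := Function.update U i _) (B := U) fun k hk => Function.update_of_ne hk _ _]
  simp only [rowProj, Matrix.mul_assoc]

theorem unfold_tangentPart_of_ne {i j : Fin m} (h : j ≠ i) (G : Tensor d) :
    ∃ X : Matrix (Fin (r j)) ((k : {k : Fin m // k ≠ j}) → Fin (d k)) ℝ,
      unfold (tangentPart C U R i G) j = U j * X := by
  rw [tangentPart, unfold_multiMul, Function.update_of_ne h, Matrix.mul_assoc]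
  exact ⟨_, rfl⟩

theorem projFamily (h : IsTuckerFrame C U R) : IsProjFamily fun j => U j * (U j)ᵀ :=
  isProjFamily_of_orthonormal h.orth

theorem compl_symm (h : IsTuckerFrame C U R) (i : Fin m) :
    (1 - U i * (U i)ᵀ)ᵀ = 1 - U i * (U i)ᵀ :=
  (compl_proj (h.projFamily.symm i) (h.projFamily.idem i)).1

theorem compl_idem (h : IsTuckerFrame C U R) (i : Fin m) :
    (1 - U i * (U i)ᵀ) * (1 - U i * (U i)ᵀ) = 1 - U i * (U i)ᵀ :=
  (compl_proj (h.projFamily.symm i) (h.projFamily.idem i)).2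

theorem compl_mul (h : IsTuckerFrame C U R) (i : Fin m) : (1 - U i * (U i)ᵀ) * U i = 0 := by
  rw [Matrix.sub_mul, Matrix.mul_assoc, h.orth]
  simp

theorem kron_orth (h : IsTuckerFrame C U R) (i : Fin m) :
    (kronExcept U i)ᵀ * kronExcept U i = 1 := by
  rw [kronExcept_transpose, kronExcept_mul]
  simp only [h.orth]
  exact kronExcept_one i

theorem rowProj_symm (h : IsTuckerFrame C U R) (i : Fin m) :
    (rowProj C U R i)ᵀ = rowProj C U R i := by
  rw [rowProj, transpose_mul, transpose_mul (kronExcept U i), transpose_transpose,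
    (h.pinv i).2.2.2, ← Matrix.mul_assoc]

theorem rowProj_idem (h : IsTuckerFrame C U R) (i : Fin m) :
    rowProj C U R i * rowProj C U R i = rowProj C U R i := by
  have h1 : R i * unfold C i * (R i * unfold C i) = R i * unfold C i := by
    rw [← Matrix.mul_assoc, (h.pinv i).2.1]
  calc rowProj C U R i * rowProj C U R i
      = kronExcept U i * (R i * unfold C i) * ((kronExcept U i)ᵀ * kronExcept U i) *
          (R i * unfold C i) * (kronExcept U i)ᵀ := by simp only [rowProj, Matrix.mul_assoc]
    _ = kronExcept U i * (R i * unfold C i * (R i * unfold C i)) * (kronExcept U i)ᵀ := by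
        rw [h.kron_orth, Matrix.mul_one, Matrix.mul_assoc (kronExcept U i)]
    _ = rowProj C U R i := by rw [h1, rowProj]

theorem unfold_mul_rowProj (h : IsTuckerFrame C U R) (i : Fin m) :
    unfold (multiMul C U) i * rowProj C U R i = unfold (multiMul C U) i := by
  calc unfold (multiMul C U) i * rowProj C U R i
      = U i * unfold C i * ((kronExcept U i)ᵀ * kronExcept U i) *
          (R i * unfold C i) * (kronExcept U i)ᵀ := by
        simp only [unfold_multiMul, rowProj, Matrix.mul_assoc]
    _ = U i * (unfold C i * R i * unfold C i) * (kronExcept U i)ᵀ := by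
        rw [h.kron_orth, Matrix.mul_one]
        simp only [Matrix.mul_assoc]
    _ = unfold (multiMul C U) i := by rw [(h.pinv i).1, unfold_multiMul]

theorem inner_tangentPart (h : IsTuckerFrame C U R) (i : Fin m) (G Z : Tensor d) :
    inner ℝ (tangentPart C U R i G) Z = inner ℝ G (tangentPart C U R i Z) := by
  rw [inner_eq_ip_unfold _ _ i, inner_eq_ip_unfold _ _ i, unfold_tangentPart, unfold_tangentPart,
    ip_mul_right, ip_mul_left, h.rowProj_symm, h.compl_symm, Matrix.mul_assoc]

theorem tangentPart_tangentPart (h : IsTuckerFrame C U R) (i : Fin m) (G : Tensor d) :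
    tangentPart C U R i (tangentPart C U R i G) = tangentPart C U R i G := by
  refine unfold_injective i ?_
  rw [unfold_tangentPart, unfold_tangentPart, ← Matrix.mul_assoc, ← Matrix.mul_assoc, h.compl_idem,
    Matrix.mul_assoc, h.rowProj_idem]

/-- In mode `i`, the columns of the `i`-th tangent part are orthogonal to those of `U i`, whereas
every other summand of the projection has its columns in their span. -/
theorem inner_tangentPart_eq_zero (h : IsTuckerFrame C U R) (i : Fin m) {X : Tensor d}
    (G : Tensor d) (hX : ∃ Y : Matrix (Fin (r i)) ((k : {k : Fin m // k ≠ i}) → Fin (d k)) ℝ,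
      unfold X i = U i * Y) :
    inner ℝ X (tangentPart C U R i G) = 0 := by
  obtain ⟨Y, hY⟩ := hX
  rw [inner_eq_ip_unfold _ _ i, unfold_tangentPart, ip_comm, Matrix.mul_assoc, ip_mul_left,
    h.compl_symm, hY, ← Matrix.mul_assoc, h.compl_mul, Matrix.zero_mul]
  simp [ip]

theorem unfold_proj (i : Fin m) (G : Tensor d) :
    ∃ Y : Matrix (Fin (r i)) ((k : {k : Fin m // k ≠ i}) → Fin (d k)) ℝ,
      unfold (multiMul G fun j => U j * (U j)ᵀ) i = U i * Y := by
  rw [unfold_multiMul, Matrix.mul_assoc, Matrix.mul_assoc]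
  exact ⟨_, rfl⟩

theorem norm_tangentProj_sq (h : IsTuckerFrame C U R) (G : Tensor d) :
    ‖tangentProj C U R G‖ ^ 2 =
      ‖multiMul G fun j => U j * (U j)ᵀ‖ ^ 2 + ∑ i, ‖tangentPart C U R i G‖ ^ 2 := by
  rw [tangentProj, norm_add_sq_real]
  have h1 : inner ℝ (multiMul G fun j => U j * (U j)ᵀ) (∑ i, tangentPart C U R i G) = 0 := by
    rw [inner_sum]
    exact Finset.sum_eq_zero fun i _ => h.inner_tangentPart_eq_zero i G (unfold_proj i G)
  have h2 : ‖∑ i, tangentPart C U R i G‖ ^ 2 = ∑ i, ‖tangentPart C U R i G‖ ^ 2 := by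
    rw [← real_inner_self_eq_norm_sq, inner_sum]
    refine Finset.sum_congr rfl fun i _ => ?_
    rw [sum_inner, Finset.sum_eq_single i, real_inner_self_eq_norm_sq]
    · intro j _ hj
      exact h.inner_tangentPart_eq_zero i G (unfold_tangentPart_of_ne hj.symm G)
    · simp
  rw [h1, h2]
  ring

theorem inner_tangentProj (h : IsTuckerFrame C U R) (G Z : Tensor d) :
    inner ℝ (tangentProj C U R G) Z = inner ℝ G (tangentProj C U R Z) := by
  rw [tangentProj, tangentProj, inner_add_left, inner_add_right, h.projFamily.inner_multiMul,
    sum_inner, inner_sum]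
  simp only [h.inner_tangentPart]

theorem compl_mul_unfold (h : IsTuckerFrame C U R) (i : Fin m) :
    (1 - U i * (U i)ᵀ) * unfold (multiMul C U) i = 0 := by
  rw [unfold_multiMul, ← Matrix.mul_assoc, ← Matrix.mul_assoc, h.compl_mul]
  simp

theorem proj_mul_unfold (h : IsTuckerFrame C U R) (i : Fin m) :
    U i * (U i)ᵀ * unfold (multiMul C U) i = unfold (multiMul C U) i := by
  have := h.compl_mul_unfold i
  rw [Matrix.sub_mul, Matrix.one_mul, sub_eq_zero] at this
  exact this.symm

theorem tangentProj_self (h : IsTuckerFrame C U R) :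
    tangentProj C U R (multiMul C U) = multiMul C U := by
  rw [tangentProj, multiMul_eq_self h.proj_mul_unfold, Finset.sum_eq_zero, add_zero]
  intro i _
  refine unfold_injective i ?_
  rw [unfold_tangentPart, h.compl_mul_unfold, Matrix.zero_mul]
  ext; simp [unfold]

theorem sq_le_of_sq_le_mul {x K : ℝ} (hx : 0 ≤ x) (h : x ^ 2 ≤ K * x) : x ^ 2 ≤ K ^ 2 := by
  rcases hx.eq_or_lt with rfl | hx
  · nlinarith [sq_nonneg K]
  · have : x ≤ K := le_of_mul_le_mul_right (by nlinarith) hx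
    gcongr

/-- Each of the m + 1 orthogonal pieces is a self-adjoint idempotent applied to `G`, so its squared
norm is its pairing with `G`. The piece has Tucker rank at most `r`, so duality bounds its norm by
`K`. -/
theorem norm_tangentProj_sq_le (h : IsTuckerFrame C U R) (G : Tensor d) {K : ℝ}
    (hK : truncNorm (fun j => 2 * r j) G ≤ K) :
    ‖tangentProj C U R G‖ ^ 2 ≤ (m + 1) * K ^ 2 := by
  have key : ∀ Z ∈ tuckerSet d r, ‖Z‖ ^ 2 = inner ℝ G Z → ‖Z‖ ^ 2 ≤ K ^ 2 := by
    intro Z hZ hGZ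
    refine sq_le_of_sq_le_mul (norm_nonneg _) ?_
    rw [hGZ]
    have hZ2 : Z ∈ tuckerSet d fun j => 2 * r j := tuckerSet_mono (fun j => by omega) hZ
    exact (inner_le_truncNorm G hZ2).trans (by gcongr)
  have h1 : ‖multiMul G fun j => U j * (U j)ᵀ‖ ^ 2 ≤ K ^ 2 := by
    refine key _ ?_ ?_
    · intro j
      exact (rank_unfold_multiMul_le _ _ j).trans ((rank_mul_le_left _ _).trans
        ((U j).rank_le_width))
    · rw [← real_inner_self_eq_norm_sq, h.projFamily.inner_multiMul, h.projFamily.multiMul_multiMul]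
  have h2 : ∀ i, ‖tangentPart C U R i G‖ ^ 2 ≤ K ^ 2 := by
    intro i
    refine key _ (multiMul_mem_tuckerSet _ _) ?_
    rw [← real_inner_self_eq_norm_sq, h.inner_tangentPart, h.tangentPart_tangentPart]
  rw [h.norm_tangentProj_sq]
  have h3 := Finset.sum_le_sum fun i (_ : i ∈ Finset.univ) => h2 i
  rw [Finset.sum_const, Finset.card_univ, Fintype.card_fin, nsmul_eq_mul] at h3
  linarith

/-- In each mode the columns lie in the span of those of `U j` and of `Z`. This is why the truncated
norm is taken at rank 2r. -/
theorem tangentProj_sub_mem_tuckerSet {Z : Tensor d} (hZ : Z ∈ tuckerSet d r) :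
    tangentProj C U R Z - Z ∈ tuckerSet d fun j => 2 * r j := by
  intro j
  have h1 : ∀ i, ∃ (X : Matrix (Fin (r j)) ((k : {k : Fin m // k ≠ j}) → Fin (d k)) ℝ)
      (Y : Matrix ((k : {k : Fin m // k ≠ j}) → Fin (d k))
        ((k : {k : Fin m // k ≠ j}) → Fin (d k)) ℝ),
      unfold (tangentPart C U R i Z) j = U j * X + unfold Z j * Y := by
    intro i
    by_cases hij : j = i
    · subst hij
      refine ⟨-((U j)ᵀ * unfold Z j * rowProj C U R j), rowProj C U R j, ?_⟩
      rw [unfold_tangentPart, Matrix.sub_mul, Matrix.sub_mul, Matrix.one_mul, Matrix.mul_neg]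
      simp only [Matrix.mul_assoc]
      abel
    · obtain ⟨X, hX⟩ := unfold_tangentPart_of_ne (C := C) (U := U) (R := R) hij Z
      exact ⟨X, 0, by rw [hX, Matrix.mul_zero, add_zero]⟩
  choose X Y hXY using h1
  obtain ⟨X₀, hX₀⟩ := unfold_proj (U := U) j Z
  have h2 : unfold (tangentProj C U R Z - Z) j =
      U j * (X₀ + ∑ i, X i) + unfold Z j * (∑ i, Y i - 1) := by
    rw [unfold_sub, tangentProj, unfold_add, unfold_sum, hX₀, Finset.sum_congr rfl fun i _ => hXY i,
      Finset.sum_add_distrib, Matrix.mul_add, Matrix.mul_sub, Matrix.mul_sum, Matrix.mul_sum,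
      Matrix.mul_one]
    abel
  rw [h2]
  refine (matrix_rank_add_le _ _).trans ?_
  change _ ≤ 2 * r j
  have h3 := (rank_mul_le_left (U j) (X₀ + ∑ i, X i)).trans (U j).rank_le_width
  have h4 := (rank_mul_le_left (unfold Z j) (∑ i, Y i - 1)).trans (hZ j)
  omega

/-- The tangent projection reproduces a nearby low-rank tensor up to a second-order error. -/
theorem norm_tangentProj_sub_le (h : IsTuckerFrame C U R) {Z : Tensor d} (hZ : Z ∈ tuckerSet d r)
    {lam : ℝ} (hlam0 : 0 < lam) (hlam : ∀ j, lam ≤ singVal (unfold Z j) (r j - 1)) :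
    ‖tangentProj C U R Z - Z‖ ≤ m * (2 * ‖multiMul C U - Z‖ ^ 2 / lam) := by
  set M := multiMul C U with hM
  set E := ‖M - Z‖ with hE
  have hP := h.projFamily
  set P : (j : Fin m) → Matrix (Fin (d j)) (Fin (d j)) ℝ := fun j => U j * (U j)ᵀ with hPdef
  have hfro : ∀ i, fro (unfold Z i - unfold M i) = E := by
    intro i
    rw [← unfold_sub, ← norm_eq_fro_unfold, norm_sub_rev]
  -- Both Z - Z·P and the sum of the tangent parts split over the modes. The matching terms are F Z
  -- K and F Z Q, which differ only in the factor acting on the row space.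
  have hstep : ∀ (S : Finset (Fin m)) (i : Fin m), i ∉ S →
      ‖multiMul Z (restrictModes P S) - multiMul Z (restrictModes P (insert i S)) -
        tangentPart C U R i Z‖ ≤ 2 * E ^ 2 / lam := by
    intro S i hi
    have hS := hP.restrictModes S
    rw [norm_eq_fro_unfold _ i, unfold_sub, unfold_restrictModes_sub S hi, unfold_tangentPart,
      hS.kronExcept_symm]
    set K := kronExcept (restrictModes P S) i with hK
    set Q := rowProj C U R i
    have hF := h.compl_symm i
    have hF2 := h.compl_idem i
    have hFM := h.compl_mul_unfold i
    set F := 1 - U i * (U i)ᵀ with hFdef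
    have hFA : ‖F * unfold Z i‖ ≤ E := by
      have h1 : F * unfold Z i = F * (unfold Z i - unfold M i) := by
        rw [Matrix.mul_sub, hFM, sub_zero]
      rw [h1, ← hfro i]
      exact (opNorm_le_fro _).trans (fro_proj_mul_le hF hF2 _)
    -- The second-order gain: F Z has norm at most E because `F` annihilates `M`, and the
    -- generalized inverse of `Z` turns the other small factor Z Y into E / `lam`.
    have hbound : ∀ Y : Matrix ((k : {k : Fin m // k ≠ i}) → Fin (d k))
        ((k : {k : Fin m // k ≠ i}) → Fin (d k)) ℝ,
        fro (unfold Z i * Y) ≤ E → fro (F * unfold Z i * Y) ≤ E ^ 2 / lam := by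
      intro Y hY
      refine (fro_mul_mul_le hlam0 (hlam i) (hZ i) F Y).trans ?_
      have h1 := fro_nonneg (unfold Z i * Y)
      calc _ ≤ E / lam * E := by gcongr
        _ = E ^ 2 / lam := by ring
    have h1 : fro (F * unfold Z i * (1 - Q)) ≤ E ^ 2 / lam := by
      refine hbound _ ?_
      have h2 : unfold Z i * (1 - Q) = (unfold Z i - unfold M i) * (1 - Q) := by
        rw [Matrix.sub_mul, Matrix.mul_sub (unfold M i), h.unfold_mul_rowProj]
        simp [hM]
      have h3 := compl_proj (h.rowProj_symm i) (h.rowProj_idem i)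
      rw [h2, ← hfro i]
      exact fro_mul_proj_le h3.1 h3.2 _
    have h4 : fro (F * unfold Z i * (1 - K)) ≤ E ^ 2 / lam := by
      refine hbound _ ?_
      have h5 : unfold Z i * (1 - K) = unfold (Z - multiMul Z (restrictModes P S)) i := by
        rw [unfold_sub_restrictModes S hi, hS.kronExcept_symm]
      have h6 : multiMul M (restrictModes P S) = M := by
        refine multiMul_eq_self fun j => ?_
        by_cases hj : j ∈ S
        · simp only [restrictModes, hj, if_true]
          exact h.proj_mul_unfold j
        · simp [restrictModes, hj]
      have h7 : Z - multiMul Z (restrictModes P S) =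
          (Z - M) - multiMul (Z - M) (restrictModes P S) := by
        rw [multiMul_sub, h6]; abel
      rw [h5, ← norm_eq_fro_unfold, h7, hE, norm_sub_rev M Z]
      exact hS.norm_sub_multiMul_le _
    have h8 : F * unfold Z i * K - F * unfold Z i * Q =
        F * unfold Z i * (1 - Q) - F * unfold Z i * (1 - K) := by
      rw [Matrix.mul_sub, Matrix.mul_sub]; abel
    rw [h8]
    refine (fro_sub_le _ _).trans ?_
    have : 2 * E ^ 2 / lam = E ^ 2 / lam + E ^ 2 / lam := by ring
    linarith
  have hsum : ∀ S : Finset (Fin m),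
      ‖Z - multiMul Z (restrictModes P S) - ∑ i ∈ S, tangentPart C U R i Z‖ ≤
        S.card * (2 * E ^ 2 / lam) := by
    intro S
    induction S using Finset.induction_on with
    | empty => simp [restrictModes_empty, multiMul_one]
    | insert i S hi ih =>
      have h1 := hstep S i hi
      rw [Finset.card_insert_of_notMem hi, Finset.sum_insert hi]
      have h2 : Z - multiMul Z (restrictModes P (insert i S)) -
          (tangentPart C U R i Z + ∑ k ∈ S, tangentPart C U R k Z) =
          (Z - multiMul Z (restrictModes P S) - ∑ k ∈ S, tangentPart C U R k Z) +
          (multiMul Z (restrictModes P S) - multiMul Z (restrictModes P (insert i S)) -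
            tangentPart C U R i Z) := by
        abel
      rw [h2]
      refine (norm_add_le _ _).trans ?_
      push_cast
      linarith
  have := hsum Finset.univ
  rw [restrictModes_univ, Finset.card_univ, Fintype.card_fin, sub_sub] at this
  rw [norm_sub_rev]
  exact this

/-- Self-adjointness moves the projection onto M - Z. It fixes M, so the only loss is `G` paired
with the second-order error at `Z`. -/
theorem inner_tangentProj_ge (h : IsTuckerFrame C U R) {Z : Tensor d} (hZ : Z ∈ tuckerSet d r)
    {lam : ℝ} (hlam0 : 0 < lam) (hlam : ∀ j, lam ≤ singVal (unfold Z j) (r j - 1))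
    (G : Tensor d) {K : ℝ} (hK : truncNorm (fun j => 2 * r j) G ≤ K) :
    inner ℝ G (multiMul C U - Z) - K * (m * (2 * ‖multiMul C U - Z‖ ^ 2 / lam)) ≤
      inner ℝ (tangentProj C U R G) (multiMul C U - Z) := by
  have h1 := inner_le_truncNorm G (tangentProj_sub_mem_tuckerSet (C := C) (U := U) (R := R) hZ)
  have h2 := h.norm_tangentProj_sub_le hZ hlam0 hlam
  have h3 := truncNorm_nonneg (fun j => 2 * r j) G
  have h4 : truncNorm (fun j => 2 * r j) G * ‖tangentProj C U R Z - Z‖ ≤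
      K * (m * (2 * ‖multiMul C U - Z‖ ^ 2 / lam)) :=
    mul_le_mul hK h2 (norm_nonneg _) (h3.trans hK)
  rw [inner_sub_right (tangentProj C U R G), h.inner_tangentProj, h.inner_tangentProj,
    h.tangentProj_self, inner_sub_right]
  rw [inner_sub_right] at h1
  linarith

end IsTuckerFrame

end Tangent

/-! ### Scalar estimates and the contraction of a single iteration. -/

section Descent

variable {m : ℕ} {d r : Fin m → ℕ}

theorem signal_le (r : Fin m → ℕ) (M : Tensor d) (j : Fin m) :
    signal r M ≤ singVal (unfold M j) (r j - 1) :=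
  ciInf_le (Set.finite_range _).bddBelow j

theorem RsGradStep.mem_tuckerSet {f : Tensor d → ℝ} {M M' : Tensor d} {η : ℝ}
    (h : RsGradStep r f M η M') : M' ∈ tuckerSet d r := by
  obtain ⟨_, _, _, _, h⟩ := h
  exact h.mem_tuckerSet

/-- The tangent sub-gradient step with a stepsize scaled to an upper bound `x` of the error `E`. -/
theorem subgradient_step_bound {a κ x E : ℝ} (ha : 1 / 4 ≤ a) (ha' : a ≤ 3 / 4) (hκ : 0 ≤ κ)
    (hκ' : κ ≤ 1 / 2) (hE : 0 ≤ E) (hEx : E ≤ x) :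
    E ^ 2 - 1.99 * (a * κ * x) * E + a ^ 2 * κ * x ^ 2 ≤ (1 - 0.4 * κ) * x ^ 2 := by
  have hx : 0 ≤ x := hE.trans hEx
  have h0 : 0 ≤ 1 - 1.99 * (a * κ) := by nlinarith [mul_nonneg (sub_nonneg.2 ha') hκ]
  have h1 : E ^ 2 ≤ x * E := by nlinarith
  have h2 : (1 - 1.99 * (a * κ)) * (x * E) ≤ (1 - 1.99 * (a * κ)) * (x * x) := by gcongr
  -- A concave function of `a`, so its minimum over [1/4, 3/4] is at an endpoint: 0.435, at a = 1/4.
  have h3 : 0.4 ≤ 1.99 * a - a ^ 2 := by nlinarith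
  have h4 : 0.4 * (κ * x ^ 2) ≤ (1.99 * a - a ^ 2) * (κ * x ^ 2) := by gcongr
  nlinarith

/-- The radius of the warm start makes the second-order errors negligible. -/
theorem warm_start_bounds {m β lam x : ℝ} (hm : 1 ≤ m) (hβ0 : 0 < β) (hβ1 : β ≤ 1)
    (hlam0 : 0 < lam) (hx0 : 0 < x) (hx₁ : x ≤ 1 / 100 * lam * (1 / (m + 1) * β ^ 2))
    (hx₂ : x ≤ 1 / 100 * lam * (1 / (m * (m + 3)) * β)) :
    m * (x / lam) ≤ β / 400 ∧ (m * (x / lam)) ^ 2 ≤ 1 / (m + 1) * β ^ 2 / 10000 ∧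
      16 * m * x ≤ lam := by
  have hm0 : 0 < m := by linarith
  set e := x / lam with he
  have he0 : 0 < e := by positivity
  have hxe : x = e * lam := by rw [he]; field_simp
  have he1 : e ≤ 1 / (m + 1) * β ^ 2 / 100 := by
    rw [he, div_le_iff₀ hlam0]; linarith
  have he2 : m * (m + 3) * e ≤ β / 100 := by
    have h1 : e ≤ 1 / 100 * (1 / (m * (m + 3)) * β) := by
      rw [he, div_le_iff₀ hlam0]; linarith
    refine (mul_le_mul_of_nonneg_left h1 (by positivity)).trans_eq ?_
    field_simp
  have h0 : 0 < m * e := by positivity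
  -- From m + 3 ≥ 4. The next bound multiplies the two warm start conditions, since each alone is
  -- only of first order in `e`.
  have hme : m * e ≤ β / 400 := by
    have : m * (m + 3) * e = m * (m * e) + 3 * (m * e) := by ring
    have : 1 * (m * e) ≤ m * (m * e) := by gcongr
    linarith
  refine ⟨hme, ?_, ?_⟩
  · calc (m * e) ^ 2 = (m * m * e) * e := by ring
      _ ≤ (m * (m + 3) * e) * e := by gcongr; linarith
      _ ≤ (1 / 100) * (1 / (m + 1) * β ^ 2 / 100) := by
          have : m * (m + 3) * e ≤ 1 / 100 := by linarith
          gcongr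
      _ = 1 / (m + 1) * β ^ 2 / 10000 := by ring
  · have h1 : 16 * m * x = 16 * (m * e) * lam := by rw [hxe]; ring
    rw [h1]
    exact mul_le_of_le_one_left hlam0.le (by linarith)

/-- The stepsize is measured against its natural unit x μ / ((m+1) L²). The linear and quadratic
terms then both become multiples of κ, with coefficients depending on the ratio `a` alone. -/
theorem stepsize_bound {m μ L η x E w W₂ : ℝ} (hm : 1 ≤ m) (hμ : 0 < μ) (hL : 0 < L)
    (hμL : μ ≤ L) (hE : 0 < E) (hEx : E ≤ x)
    (hη : η ∈ Set.Icc (0.25 / (m + 1) * x * μ / L ^ 2) (0.75 / (m + 1) * x * μ / L ^ 2))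
    (hw : 0.995 * (μ * E) ≤ w) (hW : W₂ ≤ (m + 1) * L ^ 2) :
    E ^ 2 - 2 * η * w + η ^ 2 * W₂ ≤ (1 - 0.4 * (1 / (m + 1) * (μ / L) ^ 2)) * x ^ 2 := by
  have hm0 : 0 < m := by linarith
  have hx0 : 0 < x := hE.trans_le hEx
  have hβ1 : μ / L ≤ 1 := (div_le_one hL).2 hμL
  have hβ0 : 0 < μ / L := by positivity
  set κ := 1 / (m + 1) * (μ / L) ^ 2 with hκ
  have hκ0 : 0 < κ := by positivity
  have hκ1 : κ ≤ 1 / 2 := by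
    have h1 : 1 / (m + 1) ≤ 1 / 2 := by
      apply one_div_le_one_div_of_le <;> linarith
    have h2 : (μ / L) ^ 2 ≤ 1 := pow_le_one₀ hβ0.le hβ1
    calc κ ≤ 1 / 2 * 1 := by rw [hκ]; gcongr
      _ = 1 / 2 := by norm_num
  have hc : 0 < 1 / (m + 1) * x * μ / L ^ 2 := by positivity
  set a := η / (1 / (m + 1) * x * μ / L ^ 2) with ha
  have hηa : η = a * (1 / (m + 1) * x * μ / L ^ 2) := by rw [ha, div_mul_cancel₀ _ hc.ne']
  have ha1 : 1 / 4 ≤ a := by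
    rw [ha, le_div_iff₀ hc]
    refine le_trans (le_of_eq ?_) hη.1
    ring
  have ha2 : a ≤ 3 / 4 := by
    rw [ha, div_le_iff₀ hc]
    refine hη.2.trans (le_of_eq ?_)
    ring
  have hη0 : 0 ≤ η := le_trans (by positivity) hη.1
  have hημ : η * μ = a * κ * x := by
    rw [hηa, hκ]; field_simp
  have hηL : η ^ 2 * ((m + 1) * L ^ 2) = a ^ 2 * κ * x ^ 2 := by
    rw [hηa, hκ]; field_simp
  refine le_trans ?_ (subgradient_step_bound ha1 ha2 hκ0.le hκ1 hE.le hEx)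
  have h3 : η * (0.995 * (μ * E)) ≤ η * w := by gcongr
  have h4 : η ^ 2 * W₂ ≤ a ^ 2 * κ * x ^ 2 := by rw [← hηL]; gcongr
  have h5 : η * (0.995 * (μ * E)) = 0.995 * (a * κ * x) * E := by rw [← hημ]; ring
  linarith

/-- The truncation costs at most 0.0032κ of the gain 0.4κ, well above the κ/8 that suffices for a
rate 1 - κ/16 after the square root. -/
theorem contraction_bound {κ x y ε : ℝ} (hκ : 0 ≤ κ) (hκ1 : κ ≤ 1) (hx : 0 ≤ x)
    (hε : ε ≤ κ / 10000) (hy : y ^ 2 ≤ (1 - 0.4 * κ) * x ^ 2 + 32 * ε * x ^ 2) :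
    y ≤ (1 - κ / 16) * x := by
  refine le_of_sq_le_sq ?_ (mul_nonneg (by linarith) hx)
  have h6 : 32 * ε * x ^ 2 ≤ 32 * (κ / 10000) * x ^ 2 := by gcongr
  have h7 : 0 ≤ κ * x ^ 2 := by positivity
  have h8 : ((1 - κ / 16) * x) ^ 2 = x ^ 2 - κ * x ^ 2 / 8 + (κ * x) ^ 2 / 256 := by ring
  have h9 : 0 ≤ (κ * x) ^ 2 := sq_nonneg _
  linarith

/-- Sharpness forces the sub-gradients to be at least as large as the sharpness constant. -/
theorem sharpness_le_of_subgradient {f : Tensor d → ℝ} {M Mstar G : Tensor d} {μ L : ℝ}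
    (hM : M ∈ tuckerSet d r) (hMstar : Mstar ∈ tuckerSet d r)
    (hG : G ∈ subgradients f M) (hK : truncNorm (fun j => 2 * r j) G ≤ L)
    (hgap : μ * ‖M - Mstar‖ ≤ f M - f Mstar) (hE0 : 0 < ‖M - Mstar‖) :
    μ * ‖M - Mstar‖ ≤ inner ℝ G (M - Mstar) ∧ μ ≤ L := by
  have hGgap : μ * ‖M - Mstar‖ ≤ inner ℝ G (M - Mstar) := by
    have h1 := hG Mstar
    rw [← neg_sub M Mstar, inner_neg_right] at h1
    linarith
  have hdiff : M - Mstar ∈ tuckerSet d fun j => 2 * r j := by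
    intro j
    have h1 : unfold (M - Mstar) j = unfold M j + unfold Mstar j *
        (-1 : Matrix ((k : {k : Fin m // k ≠ j}) → Fin (d k)) _ ℝ) := by
      rw [unfold_sub, Matrix.mul_neg, Matrix.mul_one, sub_eq_add_neg]
    rw [h1]
    refine (matrix_rank_add_le _ _).trans ?_
    change _ ≤ 2 * r j
    have h2 := Matrix.rank_mul_le_left (unfold Mstar j)
      (-1 : Matrix ((k : {k : Fin m // k ≠ j}) → Fin (d k))
        ((k : {k : Fin m // k ≠ j}) → Fin (d k)) ℝ)
    have h3 := hM j
    have h4 := hMstar j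
    omega
  refine ⟨hGgap, le_of_mul_le_mul_right ?_ hE0⟩
  refine hGgap.trans ((inner_le_truncNorm G hdiff).trans ?_)
  gcongr

/-- One iteration contracts any upper bound `x` of the error to which the stepsize is adapted. -/
theorem RsGradStep.norm_sub_le {f : Tensor d → ℝ} {M M' Mstar : Tensor d} {η μ L lam x : ℝ}
    (h : RsGradStep r f M η M') (hm : 1 ≤ m) (hMstar : Mstar ∈ tuckerSet d r)
    (hM : M ∈ tuckerSet d r) (hlam0 : 0 < lam)
    (hlam : ∀ j, lam ≤ singVal (unfold Mstar j) (r j - 1)) (hμ : 0 < μ) (hL : 0 < L)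
    (hgap : μ * ‖M - Mstar‖ ≤ f M - f Mstar)
    (hsub : ∀ G ∈ subgradients f M, truncNorm (fun j => 2 * r j) G ≤ L)
    (hE0 : 0 < ‖M - Mstar‖) (hEx : ‖M - Mstar‖ ≤ x)
    (hx₁ : x ≤ 1 / 100 * lam * (1 / ((m : ℝ) + 1) * (μ ^ 2 / L ^ 2)))
    (hx₂ : x ≤ 1 / 100 * lam * (1 / ((m : ℝ) * ((m : ℝ) + 3)) * (μ / L)))
    (hη : η ∈ Set.Icc (0.25 / ((m : ℝ) + 1) * x * μ / L ^ 2)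
      (0.75 / ((m : ℝ) + 1) * x * μ / L ^ 2)) :
    ‖M' - Mstar‖ ≤ (1 - 1 / (16 * ((m : ℝ) + 1)) * (μ ^ 2 / L ^ 2)) * x := by
  obtain ⟨G, hG, W, ⟨C, U, R, hU, hMC, hR, hW⟩, hT⟩ := h
  have hfr : IsTuckerFrame C U R := ⟨hU, hR⟩
  replace hW : W = tangentProj C U R G := hW
  have hm1 : (1 : ℝ) ≤ m := by exact_mod_cast hm
  have hx0 : 0 < x := hE0.trans_le hEx
  have hK := hsub G hG
  obtain ⟨hGgap, hμL⟩ := sharpness_le_of_subgradient hM hMstar hG hK hgap hE0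
  have hβ0 : 0 < μ / L := by positivity
  have hβ1 : μ / L ≤ 1 := (div_le_one hL).2 hμL
  rw [← div_pow] at hx₁ ⊢
  obtain ⟨hme, hme2, hmx⟩ := warm_start_bounds hm1 hβ0 hβ1 hlam0 hx0 hx₁ hx₂
  have hW1 : ‖W‖ ^ 2 ≤ (m + 1) * L ^ 2 := by
    rw [hW]; exact hfr.norm_tangentProj_sq_le G hK
  have hW2 : 0.995 * (μ * ‖M - Mstar‖) ≤ inner ℝ W (M - Mstar) := by
    have h1 := hfr.inner_tangentProj_ge hMstar hlam0 hlam G hK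
    rw [← hW, ← hMC] at h1
    -- The curvature loss is half a percent of μE, whence the constant 0.995.
    have h2 : L * (m * (2 * ‖M - Mstar‖ ^ 2 / lam)) ≤ 0.005 * (μ * ‖M - Mstar‖) := by
      have h3 : m * (‖M - Mstar‖ / lam) ≤ μ / L / 400 := le_trans (by gcongr) hme
      calc L * (m * (2 * ‖M - Mstar‖ ^ 2 / lam))
          = 2 * L * ‖M - Mstar‖ * (m * (‖M - Mstar‖ / lam)) := by ring
        _ ≤ 2 * L * ‖M - Mstar‖ * (μ / L / 400) := by gcongr
        _ = 0.005 * (μ * ‖M - Mstar‖) := by field_simp; norm_num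
    linarith
  have hTx : ‖M - η • W - Mstar‖ ^ 2 ≤ (1 - 0.4 * (1 / ((m : ℝ) + 1) * (μ / L) ^ 2)) * x ^ 2 := by
    have h1 : M - η • W - Mstar = (M - Mstar) - η • W := by abel
    have h2 : ‖M - η • W - Mstar‖ ^ 2 =
        ‖M - Mstar‖ ^ 2 - 2 * η * inner ℝ W (M - Mstar) + η ^ 2 * ‖W‖ ^ 2 := by
      rw [h1, norm_sub_sq_real, inner_smul_right, norm_smul, mul_pow, Real.norm_eq_abs, sq_abs,
        real_inner_comm]
      ring
    rw [h2]
    exact stepsize_bound hm1 hμ hL hμL hE0 hEx hη hW2 hW1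
  have hκ0 : 0 < 1 / ((m : ℝ) + 1) * (μ / L) ^ 2 := by positivity
  have hκ1 : 1 / ((m : ℝ) + 1) * (μ / L) ^ 2 ≤ 1 := by
    have h1 : 1 / ((m : ℝ) + 1) ≤ 1 := by
      rw [div_le_one (by linarith)]; linarith
    exact mul_le_one₀ h1 (by positivity) (pow_le_one₀ hβ0.le hβ1)
  have hq : 1 - 1 / (16 * ((m : ℝ) + 1)) * (μ / L) ^ 2 =
      1 - 1 / ((m : ℝ) + 1) * (μ / L) ^ 2 / 16 := by
    field_simp
  rw [hq]
  generalize 1 / ((m : ℝ) + 1) * (μ / L) ^ 2 = κ at *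
  have hTx' : ‖M - η • W - Mstar‖ ≤ x := by
    refine le_of_sq_le_sq (hTx.trans ?_) hx0.le
    exact mul_le_of_le_one_left (sq_nonneg x) (by linarith)
  have hH := norm_hosvd_sub_sq_le hMstar hT hlam0 hlam hm hTx' hmx
  exact contraction_bound hκ0.le hκ1 hx0.le hme2 (hH.trans (by gcongr))

end Descent

end TensorRsGrad

/-! ### The two phases and the induction over the iterates. -/

theorem mainTheorem7 :
    ∃ c₀ : ℝ, 0 < c₀ ∧
      ∀ (m : ℕ) (d r : Fin m → ℕ), 1 ≤ m → (∀ j, 1 ≤ r j) →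
      ∀ (f : Tensor d → ℝ) (Mstar : Tensor d), Mstar ∈ tuckerSet d r →
      ∀ (τcomp τstat μcomp μstat Lcomp Lstat : ℝ),
        0 < τstat → τstat < τcomp → 0 < μcomp → 0 < μstat → 0 < Lcomp → 0 < Lstat →
        DualPhaseSharp r f Mstar τcomp τstat μcomp μstat →
        DualPhaseSubgradBound r f Mstar τcomp τstat Lcomp Lstat →
      ∀ (lmax : ℕ) (M : ℕ → Tensor d) (η : ℕ → ℝ) (η₀ : ℝ),
        -- the iterates of the algorithm
        M 0 ∈ tuckerSet d r →
        (∀ l ≤ lmax, RsGradStep r f (M l) (η l) (M (l + 1))) →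
        -- the warm start
        ‖M 0 - Mstar‖ ≤ c₀ * signal r Mstar *
          min (min (1 / ((m : ℝ) + 1) * (μstat ^ 2 / Lstat ^ 2))
                (1 / ((m : ℝ) + 1) * (μcomp ^ 2 / Lcomp ^ 2)))
              (min (1 / ((m : ℝ) * ((m : ℝ) + 3)) * (μstat / Lstat))
                (1 / ((m : ℝ) * ((m : ℝ) + 3)) * (μcomp / Lcomp))) →
        -- the stepsizes
        η₀ ∈ Set.Icc (0.25 / ((m : ℝ) + 1) * ‖M 0 - Mstar‖ * μcomp / Lcomp ^ 2)
          (0.75 / ((m : ℝ) + 1) * ‖M 0 - Mstar‖ * μcomp / Lcomp ^ 2) →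
        (∀ l ≤ lmax, τcomp ≤ ‖M l - Mstar‖ →
          η l = (1 - 1 / (16 * ((m : ℝ) + 1)) * (μcomp ^ 2 / Lcomp ^ 2)) ^ l * η₀) →
        (∀ l ≤ lmax, τstat ≤ ‖M l - Mstar‖ → ‖M l - Mstar‖ < τcomp →
          η l ∈ Set.Icc (0.25 / ((m : ℝ) + 1) * μstat / Lstat ^ 2)
            (0.75 / ((m : ℝ) + 1) * μstat / Lstat ^ 2)) →
      ∀ l ≤ lmax, (∀ k < l, τstat ≤ ‖M k - Mstar‖) →
        (τcomp ≤ ‖M l - Mstar‖ →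
          ‖M l - Mstar‖ ≤
              (1 - 1 / (16 * ((m : ℝ) + 1)) * (μcomp ^ 2 / Lcomp ^ 2)) ^ l * ‖M 0 - Mstar‖ ∧
          ‖M (l + 1) - Mstar‖ ≤
              (1 - 1 / (16 * ((m : ℝ) + 1)) * (μcomp ^ 2 / Lcomp ^ 2)) ^ (l + 1) *
                ‖M 0 - Mstar‖) ∧
        (τstat ≤ ‖M l - Mstar‖ → ‖M l - Mstar‖ < τcomp →
          ‖M (l + 1) - Mstar‖ ≤
              (1 - 1 / (16 * ((m : ℝ) + 1)) * (μstat ^ 2 / Lstat ^ 2)) * ‖M l - Mstar‖) := by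
  refine ⟨1 / 100, by norm_num, ?_⟩
  intro m d r hm _ f Mstar hMstar τcomp τstat μcomp μstat Lcomp Lstat hτ hττ hμc hμs hLc hLs hsharp
    hsub lmax M η η₀ hM0 hstep hwarm hη₀ hη₁ hη₂
  set E : ℕ → ℝ := fun l => ‖M l - Mstar‖ with hE
  set q := 1 - 1 / (16 * ((m : ℝ) + 1)) * (μcomp ^ 2 / Lcomp ^ 2) with hq
  set q₂ := 1 - 1 / (16 * ((m : ℝ) + 1)) * (μstat ^ 2 / Lstat ^ 2) with hq₂
  have hm1 : (1 : ℝ) ≤ m := by exact_mod_cast hm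
  have hq1 : q ≤ 1 := sub_le_self _ (by positivity)
  have hq₂1 : q₂ ≤ 1 := sub_le_self _ (by positivity)
  intro l₀ hl₀ hbefore
  suffices hmain : τstat ≤ E l₀ →
      (τcomp ≤ E l₀ → E l₀ ≤ q ^ l₀ * E 0 ∧ E (l₀ + 1) ≤ q ^ (l₀ + 1) * E 0) ∧
        (E l₀ < τcomp → E (l₀ + 1) ≤ q₂ * E l₀) from
    ⟨fun h => (hmain (hττ.le.trans h)).1 h, fun h h' => (hmain h).2 h'⟩
  intro hl₀τ
  have hE0 : 0 < E 0 := by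
    rcases Nat.eq_zero_or_pos l₀ with h | h
    · subst h; exact hτ.trans_le hl₀τ
    · exact hτ.trans_le (hbefore 0 h)
  have hmin : 0 < min (min (1 / ((m : ℝ) + 1) * (μstat ^ 2 / Lstat ^ 2))
                (1 / ((m : ℝ) + 1) * (μcomp ^ 2 / Lcomp ^ 2)))
              (min (1 / ((m : ℝ) * ((m : ℝ) + 3)) * (μstat / Lstat))
                (1 / ((m : ℝ) * ((m : ℝ) + 3)) * (μcomp / Lcomp))) := by
    refine lt_min (lt_min ?_ ?_) (lt_min ?_ ?_) <;> positivity
  -- A vanishing signal would force a zero initial error through the warm start.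
  have hlam0 : 0 < signal r Mstar := by
    by_contra hneg
    have h1 : 1 / 100 * signal r Mstar ≤ 0 := by linarith [not_lt.1 hneg]
    have h2 := mul_nonpos_of_nonpos_of_nonneg h1 hmin.le
    exact absurd (hE0.trans_le hwarm) (not_lt.2 h2)
  have hwarm' : ∀ y, min (min (1 / ((m : ℝ) + 1) * (μstat ^ 2 / Lstat ^ 2))
                (1 / ((m : ℝ) + 1) * (μcomp ^ 2 / Lcomp ^ 2)))
              (min (1 / ((m : ℝ) * ((m : ℝ) + 3)) * (μstat / Lstat))
                (1 / ((m : ℝ) * ((m : ℝ) + 3)) * (μcomp / Lcomp))) ≤ y →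
      E 0 ≤ 1 / 100 * signal r Mstar * y := fun y hy =>
    hwarm.trans (mul_le_mul_of_nonneg_left hy (by positivity))
  have hlam := signal_le r Mstar
  have phaseOne : ∀ l ≤ lmax, M l ∈ tuckerSet d r → τcomp ≤ E l → E l ≤ q ^ l * E 0 →
      q ^ l * E 0 ≤ E 0 → E (l + 1) ≤ q ^ (l + 1) * E 0 := by
    intro l hl hMl hτl hEl hx
    have hEl0 : 0 < E l := (hτ.trans hττ).trans_le hτl
    -- `q` is not known to be non-negative beforehand, as μcomp ≤ Lcomp follows only from an iterate
    -- in the far region. The positive error below the majorant supplies the sign.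
    have hql : 0 < q ^ l := pos_of_mul_pos_left (hEl0.trans_le hEl) hE0.le
    rw [pow_succ', mul_assoc]
    refine (hstep l hl).norm_sub_le hm hMstar hMl hlam0 hlam hμc hLc (hsharp.1 _ ⟨hMl, hτl⟩)
      (hsub.1 _ ⟨hMl, hτl⟩) hEl0 hEl
      (hx.trans (hwarm' _ ((min_le_left _ _).trans (min_le_right _ _))))
      (hx.trans (hwarm' _ ((min_le_right _ _).trans (min_le_right _ _)))) ?_
    rw [hη₁ l hl hτl]
    constructor
    · refine le_trans (le_of_eq ?_) (mul_le_mul_of_nonneg_left hη₀.1 hql.le)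
      ring
    · refine (mul_le_mul_of_nonneg_left hη₀.2 hql.le).trans (le_of_eq ?_)
      ring
  have phaseTwo : ∀ l ≤ lmax, M l ∈ tuckerSet d r → τstat ≤ E l → E l < τcomp → E l ≤ E 0 →
      E (l + 1) ≤ q₂ * E l := by
    intro l hl hMl hτl hτl' hEl
    have hEl0 : 0 < E l := hτ.trans_le hτl
    -- Quadratic sharpness is linear sharpness with slope `μstat * E l`. Together with the bound
    -- `Lstat * E l`, the error cancels from the ratio and from the stepsize range.
    have hratio : μstat * E l / (Lstat * E l) = μstat / Lstat := mul_div_mul_right _ _ hEl0.ne'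
    have hratio2 : (μstat * E l) ^ 2 / (Lstat * E l) ^ 2 = μstat ^ 2 / Lstat ^ 2 := by
      rw [← div_pow, hratio, div_pow]
    have hstep2 : ∀ c : ℝ, c * E l * (μstat * E l) / (Lstat * E l) ^ 2 = c * μstat / Lstat ^ 2 := by
      intro c; field_simp
    have h := (hstep l hl).norm_sub_le (μ := μstat * E l) (L := Lstat * E l) (x := E l) hm hMstar
      hMl hlam0 hlam (by positivity) (by positivity)
      (by
        refine le_trans (le_of_eq ?_) (hsharp.2 _ ⟨hMl, hτl, hτl'⟩)
        simp only [hE]; ring)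
      (hsub.2 _ ⟨hMl, hτl, hτl'⟩) hEl0 le_rfl
      (by
        rw [hratio2]
        exact hEl.trans (hwarm' _ ((min_le_left _ _).trans (min_le_left _ _))))
      (by
        rw [hratio]
        exact hEl.trans (hwarm' _ ((min_le_right _ _).trans (min_le_left _ _))))
      (by
        rw [hstep2, hstep2]
        exact hη₂ l hl hτl hτl')
    rwa [hratio2] at h
  -- The majorant is claimed only for iterates in phase one. Errors do not increase in phase two, so
  -- the far region is never re-entered and phase one is an initial segment.
  have inv : ∀ l ≤ l₀, M l ∈ tuckerSet d r ∧ E l ≤ E 0 ∧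
      (τcomp ≤ E l → E l ≤ q ^ l * E 0 ∧ q ^ l * E 0 ≤ E 0) := by
    intro l
    induction l with
    | zero => intro _; simpa using hM0
    | succ l ih =>
      intro hl
      obtain ⟨hMl, hEl, hEl'⟩ := ih (by omega)
      have hlmax : l ≤ lmax := by omega
      have hτl : τstat ≤ E l := hbefore l (by omega)
      refine ⟨(hstep l hlmax).mem_tuckerSet, ?_⟩
      rcases le_or_gt τcomp (E l) with h | h
      · obtain ⟨h1, h2⟩ := hEl' h
        have h3 := phaseOne l hlmax hMl h h1 h2
        have h4 : q ^ (l + 1) * E 0 ≤ E 0 := by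
          rw [pow_succ', mul_assoc]
          exact (mul_le_of_le_one_left ((hτ.trans_le hτl).le.trans h1) hq1).trans h2
        exact ⟨h3.trans h4, fun _ => ⟨h3, h4⟩⟩
      · have h3 := phaseTwo l hlmax hMl hτl h hEl
        have h4 : E (l + 1) ≤ E l := h3.trans (mul_le_of_le_one_left (hτ.trans_le hτl).le hq₂1)
        exact ⟨h4.trans hEl, fun h5 => absurd (h5.trans h4) (not_le.2 h)⟩
  obtain ⟨hMl, hEl, hEl'⟩ := inv l₀ le_rfl
  refine ⟨fun h => ?_, fun h => phaseTwo l₀ hl₀ hMl hl₀τ h hEl⟩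
  obtain ⟨h1, h2⟩ := hEl' h
  exact ⟨h1, phaseOne l₀ hl₀ hMl h h1 h2⟩
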